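/- Let $(\Omega,\nu)$ be a standard Borel space with a finite, nonzero, nonatomic measure, and let $P$ be an invertible bimeasurable transformation of $\Omega$ that preserves $\nu$ and is ergodic. Let $\mathbf Z_2$ be the compact group of dyadic integers with its Borel $\sigma$-algebra and its normalized Haar measure $\mu$, and let $T x=x+1$ be the dyadic odometer on $\mathbf Z_2$. Then there are an invertible bimeasurable transformation $S$ of $\mathbf Z_2$ preserving $\mu$ and a measurable function $n:\mathbf Z_2\to\mathbf Z$ such that 1. $S$ is isomorphic to $P$ mod $0$: there is an isomorphism mod $0$ of measure spaces $\varphi:(\Omega,\nu)\to(\mathbf Z_2,\nu(\Omega)\,\mu)$ with $\varphi(P\omega)=S\varphi(\omega)$ for $\nu$-almost every $\omega$; 2. $Sx=T^{n(x)}x=x+n(x)$ for every $x\in\mathbf Z_2$; 3. every orbit $\{S^kx:k\in\mathbf Z\}$ of $S$ is contained in the orbit $\{T^kx:k\in\mathbf Z\}$ of $T$; 4. for $\mu$-almost every $x$, the $T$-orbit of $x$ is a union of countably infinitely many distinct orbits of $S$. -/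

import Mathlib

open MeasureTheory

/-- The space of dyadic integers carries its Borel σ-algebra. -/
noncomputable instance dyadicMeasurableSpace : MeasurableSpace ℤ_[2] := borel ℤ_[2]

instance dyadicBorelSpace : BorelSpace ℤ_[2] := ⟨rfl⟩

/-- The Haar measure of the compact group of dyadic integers, of total mass one. -/
noncomputable def dyadicHaar : Measure ℤ_[2] :=
  Measure.addHaarMeasure (⊤ : TopologicalSpace.PositiveCompacts ℤ_[2])

/-- The dyadic odometer, addition of unity on the dyadic integers. -/
noncomputable def odometer : ℤ_[2] ≃ᵐ ℤ_[2] := MeasurableEquiv.addRight 1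

/-- The (two-sided) orbit of a point under an invertible transformation. -/
def fullOrbit {X : Type*} [MeasurableSpace X] (S : X ≃ᵐ X) (x : X) : Set X :=
  {y | ∃ k : ℤ, (S.toEquiv ^ k : Equiv.Perm X) x = y}

/-- An isomorphism mod 0 of measure spaces: a measure preserving map with a measure preserving
inverse, up to null sets. -/
def IsIsoModZero {X Y : Type*} [MeasurableSpace X] [MeasurableSpace Y]
    (φ : X → Y) (μ : Measure X) (ν : Measure Y) : Prop :=
  MeasurePreserving φ μ ν ∧ ∃ ψ : Y → X, MeasurePreserving ψ ν μ ∧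
    (∀ᵐ x ∂μ, ψ (φ x) = x) ∧ (∀ᵐ y ∂ν, φ (ψ y) = y)

/-! The heart is `exists_digits`: almost every point gets an infinite string of fair independent
binary digits which separates points off a null set and which, almost surely, changes in only
finitely many places when `P` is applied. Strings with equal tails have dyadic values differing by
an integer, so reading the digits in `ℤ_[2]` turns `P` into a map moving each point inside its
odometer orbit.

The digits come from successive arrays. An array divides the current base into `2 ^ k` labelled
classes, each carried onto a smaller base along `P`-orbits; labels of nested arrays concatenate. Two
things are needed at stage `n`, off a set of measure at most `2⁻ⁿ`: `x` and `P x` have the same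
projection, which freezes all later digits, and the label determines the first `n` coordinates of a
separating code. Both come from `exists_array_of_tower`. A tower over a rarely visited set `C` is
cut into columns whose levels are monochromatic; the levels are labels, and every level of a column
is projected through the same map, so that the projection is constant up the column. Ergodicity
enters through towers filling the space and through `exists_piecewise_iterate`, which matches sets
of equal measure along orbits. `IsArray.exists_refinement` transfers this from the base to the whole
space, and Borel–Cantelli finishes.

To have infinitely many `S`-orbits in a `T`-orbit, the digits are recoded by `twist`, a triangular
bijection of strings. It preserves uniformity and sends equal tails to equal tails, but its inverse
does not: flipping one odd digit after twisting alters infinitely many digits before it. Different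
flips thus stay in one `T`-orbit while giving different tail classes of untwisted strings, and those
classes are invariant under `S`. -/

open Set Filter Topology
open scoped ENNReal

/-! ### Cutting sets of prescribed measure in an atomless space -/

section Atomless

variable {Ω : Type*} [MeasurableSpace Ω] [StandardBorelSpace Ω] {ν : Measure Ω}

/-- A finite measure without atoms takes all intermediate values on the subsets of a set. -/
theorem exists_subset_measure_eq [IsFiniteMeasure ν] [NullSingletonClass ν] {A : Set Ω}
    (hA : MeasurableSet A) {c : ℝ≥0∞} (hc : c ≤ ν A) :
    ∃ B ⊆ A, MeasurableSet B ∧ ν B = c := by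
  rcases hc.eq_or_lt with rfl | hlt
  · exact ⟨A, subset_rfl, hA, rfl⟩
  rcases eq_or_ne c 0 with rfl | h0
  · exact ⟨∅, empty_subset _, MeasurableSet.empty, measure_empty⟩
  have hf := measurableEmbedding_embeddingReal Ω
  set f := embeddingReal Ω with hfdef
  set ρ : Measure ℝ := (ν.restrict A).map f with hρ
  have hρ_apply : ∀ s, MeasurableSet s → ρ s = ν (f ⁻¹' s ∩ A) := fun s hs => by
    rw [hρ, Measure.map_apply hf.measurable hs, Measure.restrict_apply (hf.measurable hs)]
  have : IsFiniteMeasure ρ := by rw [hρ]; infer_instance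
  have : NullSingletonClass ρ := ⟨fun x => by
    rw [hρ_apply _ (measurableSet_singleton x)]
    refine measure_mono_null inter_subset_left ?_
    exact (Set.Subsingleton.preimage (subsingleton_singleton) hf.injective).measure_zero ν⟩
  -- Absence of atoms makes the distribution function of `ρ` continuous; the intermediate value
  -- theorem then supplies a half-line of measure `c`.
  have hcont : Continuous fun t => ρ.real (Iic t) := by
    rw [continuous_iff_continuousAt]
    intro t
    have h := ((integrable_const (μ := ρ) (1 : ℝ)).integrableOn
      (s := Iic (t + 1))).continuousOn_Iic_primitive_Iic.continuousAt (Iic_mem_nhds (lt_add_one t))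
    refine h.congr (Eventually.of_forall fun b => ?_)
    simp
  have hctop : c ≠ ∞ := (hlt.trans_le le_top).ne
  have hbot : ∃ t, ρ.real (Iic t) ≤ c.toReal := by
    have h := tendsto_measure_iInter_atBot (μ := ρ) (s := fun t : ℝ => Iic t)
      (fun t => measurableSet_Iic.nullMeasurableSet) (fun a b h => Iic_subset_Iic.2 h)
      ⟨0, measure_ne_top _ _⟩
    have he : ⋂ t : ℝ, Iic t = ∅ := iInter_Iic_eq_empty_iff.2 (by simp [not_bddBelow_univ])
    rw [he, measure_empty] at h
    obtain ⟨t, ht⟩ := (h.eventually (Iio_mem_nhds (pos_iff_ne_zero.2 h0))).exists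
    exact ⟨t, ENNReal.toReal_mono hctop (le_of_lt ht)⟩
  have htop : ∃ t, c.toReal ≤ ρ.real (Iic t) := by
    have h := tendsto_measure_Iic_atTop ρ
    have hu : c < ρ univ := by simpa [hρ_apply univ MeasurableSet.univ] using hlt
    obtain ⟨t, ht⟩ := (h.eventually (Ioi_mem_nhds hu)).exists
    exact ⟨t, ENNReal.toReal_mono (measure_ne_top _ _) (le_of_lt ht)⟩
  obtain ⟨t, ht⟩ := mem_range_of_exists_le_of_exists_ge hcont hbot htop
  refine ⟨f ⁻¹' Iic t ∩ A, inter_subset_right, (hf.measurable measurableSet_Iic).inter hA, ?_⟩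
  rw [← hρ_apply _ measurableSet_Iic]
  exact (ENNReal.toReal_eq_toReal_iff' (measure_ne_top _ _) hctop).1 ht

/-- A set of measure `n * q` can be cut, up to a null set, into `n` sets of measure `q`. -/
theorem exists_partition_of_measure_eq [IsFiniteMeasure ν] [NullSingletonClass ν] (q : ℝ≥0∞)
    (n : ℕ) : ∀ A : Set Ω, MeasurableSet A → ν A = n * q →
    ∃ X : Fin n → Set Ω, (∀ i, MeasurableSet (X i)) ∧ (∀ i, ν (X i) = q) ∧
      Pairwise (fun i j => Disjoint (X i) (X j)) ∧ (∀ i, X i ⊆ A) ∧ ν (A \ ⋃ i, X i) = 0 := by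
  induction n with
  | zero =>
    intro A hA hm
    exact ⟨Fin.elim0, fun i => i.elim0, fun i => i.elim0, fun i => i.elim0, fun i => i.elim0,
      by simpa using hm⟩
  | succ n ih =>
    intro A hA hm
    have hqA : q ≤ ν A := by
      rw [hm]; push_cast
      calc q = 1 * q := (one_mul q).symm
        _ ≤ _ := by gcongr; exact le_add_self
    obtain ⟨B, hBA, hB, hBq⟩ := exists_subset_measure_eq hA hqA
    have hq : q ≠ ∞ := (hqA.trans_lt (measure_lt_top _ _)).ne
    have hdiff : ν (A \ B) = n * q := by
      rw [measure_sdiff hBA hB.nullMeasurableSet (measure_ne_top _ _), hm, hBq]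
      push_cast
      rw [add_mul, one_mul]
      exact ENNReal.add_sub_cancel_right hq
    obtain ⟨X, hX, hXq, hXd, hXA, hX0⟩ := ih _ (hA.diff hB) hdiff
    have hdis : ∀ i, Disjoint B (X i) := fun i => disjoint_sdiff_right.mono_right (hXA i)
    refine ⟨Fin.cons B X, ?_, ?_, ?_, ?_, ?_⟩
    · intro i; refine Fin.cases ?_ (fun i => ?_) i <;> simp [hB, hX]
    · intro i; refine Fin.cases ?_ (fun i => ?_) i <;> simp [hBq, hXq]
    · intro i j
      refine Fin.cases ?_ (fun i => ?_) i <;> refine Fin.cases ?_ (fun j => ?_) j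
      · intro h; exact absurd rfl h
      · intro _; simpa using hdis j
      · intro _; simpa using (hdis i).symm
      · intro h; simpa using hXd (fun e => h (by rw [e]))
    · intro i
      refine Fin.cases ?_ (fun i => ?_) i
      · simpa using hBA
      · simpa using (hXA i).trans sdiff_subset
    · rw [iUnion_cons]
      simpa [sdiff_sdiff] using hX0

/-- A measurable set with a finite colouring can be cut into monochromatic pieces of measure `q`
and a remainder of measure at most `q` times the number of colours. -/
theorem exists_monochromatic_pieces [IsFiniteMeasure ν] [NullSingletonClass ν] {T : Type*}
    [Fintype T] [MeasurableSpace T] [MeasurableSingletonClass T] {τ : Ω → T} (hτ : Measurable τ)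
    {q : ℝ≥0∞} (m : ℕ) : ∀ A : Set Ω, MeasurableSet A → ν A ≤ m * q →
    ∃ (r : ℕ) (W : Fin r → Set Ω) (t : Fin r → T), (∀ i, MeasurableSet (W i)) ∧
      (∀ i, ν (W i) = q) ∧ (∀ i, W i ⊆ A) ∧ Pairwise (fun i j => Disjoint (W i) (W j)) ∧
      (∀ i, ∀ x ∈ W i, τ x = t i) ∧ ν (A \ ⋃ i, W i) ≤ Fintype.card T * q := by
  have done : ∀ A : Set Ω, ν A ≤ Fintype.card T * q →
    ∃ (r : ℕ) (W : Fin r → Set Ω) (t : Fin r → T), (∀ i, MeasurableSet (W i)) ∧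
      (∀ i, ν (W i) = q) ∧ (∀ i, W i ⊆ A) ∧ Pairwise (fun i j => Disjoint (W i) (W j)) ∧
      (∀ i, ∀ x ∈ W i, τ x = t i) ∧ ν (A \ ⋃ i, W i) ≤ Fintype.card T * q := fun A h =>
    ⟨0, Fin.elim0, Fin.elim0, fun i => i.elim0, fun i => i.elim0, fun i => i.elim0,
      fun i => i.elim0, fun i => i.elim0, by simpa using h⟩
  induction m with
  | zero => intro A _ h; exact done A (h.trans (by simp))
  | succ m ih =>
    intro A hA hm
    by_cases hsmall : ν A ≤ Fintype.card T * q
    · exact done A hsmall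
    -- Pigeonhole: if every colour class had measure below `q`, the whole set would already be small
    -- enough to stop. The bound `m` only counts how many extractions remain possible.
    obtain ⟨t₀, ht₀⟩ : ∃ t, q ≤ ν (A ∩ τ ⁻¹' {t}) := by
      by_contra! hcon
      refine hsmall ?_
      calc ν A ≤ ν (⋃ t, A ∩ τ ⁻¹' {t}) := measure_mono fun x hx => mem_iUnion.2 ⟨τ x, hx, rfl⟩
        _ ≤ ∑ t, ν (A ∩ τ ⁻¹' {t}) := measure_iUnion_fintype_le _ _
        _ ≤ ∑ _t : T, q := Finset.sum_le_sum fun t _ => (hcon t).le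
        _ = _ := by simp
    obtain ⟨B, hBA, hB, hBq⟩ := exists_subset_measure_eq
      (hA.inter (hτ (measurableSet_singleton t₀))) ht₀
    have hq : q ≠ ∞ := (ht₀.trans_lt (measure_lt_top _ _)).ne
    have hBA' := hBA.trans inter_subset_left
    have hdiff : ν (A \ B) ≤ m * q := by
      rw [measure_sdiff hBA' hB.nullMeasurableSet (measure_ne_top _ _), hBq]
      push_cast at hm
      rw [add_mul, one_mul] at hm
      exact tsub_le_iff_right.2 hm
    obtain ⟨r, W, t, hW, hWq, hWA, hWd, hWt, hrem⟩ := ih _ (hA.diff hB) hdiff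
    have hdis : ∀ i, Disjoint B (W i) := fun i => disjoint_sdiff_right.mono_right (hWA i)
    refine ⟨r + 1, Fin.cons B W, Fin.cons t₀ t, ?_, ?_, ?_, ?_, ?_, ?_⟩
    · intro i; refine Fin.cases ?_ (fun i => ?_) i <;> simp [hB, hW]
    · intro i; refine Fin.cases ?_ (fun i => ?_) i <;> simp [hBq, hWq]
    · intro i
      refine Fin.cases ?_ (fun i => ?_) i
      · simpa using hBA'
      · simpa using (hWA i).trans sdiff_subset
    · intro i j
      refine Fin.cases ?_ (fun i => ?_) i <;> refine Fin.cases ?_ (fun j => ?_) j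
      · intro h; exact absurd rfl h
      · intro _; simpa using hdis j
      · intro _; simpa using (hdis i).symm
      · intro h; simpa using hWd (fun e => h (by rw [e]))
    · intro i
      refine Fin.cases ?_ (fun i => ?_) i
      · simpa using fun x hx => (hBA hx).2
      · simpa using hWt i
    · rw [iUnion_cons]
      simpa [sdiff_sdiff] using hrem

end Atomless

/-! ### Integer iterates and ergodic matching of sets -/

section Iterates

variable {Ω : Type*} [MeasurableSpace Ω]

/-- The integer iterates of an invertible transformation. -/
def iterZ (P : Ω ≃ᵐ Ω) (k : ℤ) : Ω → Ω := ⇑(P.toEquiv ^ k : Equiv.Perm Ω)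

variable (P : Ω ≃ᵐ Ω)

theorem iterZ_zero (x : Ω) : iterZ P 0 x = x := by simp [iterZ]

theorem iterZ_one (x : Ω) : iterZ P 1 x = P x := by simp [iterZ]

theorem iterZ_add (j k : ℤ) (x : Ω) : iterZ P (j + k) x = iterZ P j (iterZ P k x) := by
  simp [iterZ, zpow_add]

theorem iterZ_neg_one (x : Ω) : iterZ P (-1) x = P.symm x := by
  have h : P (iterZ P (-1) x) = x := by rw [← iterZ_one P, ← iterZ_add]; simp [iterZ_zero]
  rw [← h, P.symm_apply_apply, h]

theorem iterZ_neg_apply (k : ℤ) (x : Ω) : iterZ P (-k) (iterZ P k x) = x := by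
  rw [← iterZ_add, neg_add_cancel, iterZ_zero]

theorem iterZ_apply_neg (k : ℤ) (x : Ω) : iterZ P k (iterZ P (-k) x) = x := by
  rw [← iterZ_add, add_neg_cancel, iterZ_zero]

theorem iterZ_injective (k : ℤ) : Function.Injective (iterZ P k) := (P.toEquiv ^ k).injective

theorem measurable_iterZ (k : ℤ) : Measurable (iterZ P k) := by
  induction k using Int.induction_on with
  | zero =>
    have : iterZ P 0 = id := funext fun x => iterZ_zero P x
    rw [this]; exact measurable_id
  | succ n ih =>
    have : iterZ P (n + 1) = iterZ P n ∘ P := funext fun x => by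
      rw [iterZ_add, iterZ_one, Function.comp_apply]
    rw [this]; exact ih.comp P.measurable
  | pred n ih =>
    have : iterZ P (-n - 1) = iterZ P (-n) ∘ P.symm := funext fun x => by
      rw [sub_eq_add_neg, iterZ_add, iterZ_neg_one, Function.comp_apply]
    rw [this]; exact ih.comp P.symm.measurable

variable {P} {ν : Measure Ω}

theorem measurePreserving_iterZ (hP : MeasurePreserving P ν ν) (k : ℤ) :
    MeasurePreserving (iterZ P k) ν ν := by
  induction k using Int.induction_on with
  | zero =>
    have : iterZ P 0 = id := funext fun x => iterZ_zero P x
    rw [this]; exact MeasurePreserving.id ν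
  | succ n ih =>
    have : iterZ P (n + 1) = iterZ P n ∘ P := funext fun x => by
      rw [iterZ_add, iterZ_one, Function.comp_apply]
    rw [this]; exact ih.comp hP
  | pred n ih =>
    have : iterZ P (-n - 1) = iterZ P (-n) ∘ P.symm := funext fun x => by
      rw [sub_eq_add_neg, iterZ_add, iterZ_neg_one, Function.comp_apply]
    rw [this]; exact ih.comp (hP.symm P)

theorem measure_preimage_iterZ (hP : MeasurePreserving P ν ν) (k : ℤ) {s : Set Ω}
    (hs : MeasurableSet s) : ν (iterZ P k ⁻¹' s) = ν s :=
  (measurePreserving_iterZ hP k).measure_preimage hs.nullMeasurableSet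

/-- Almost every orbit of an ergodic transformation meets a set of positive measure in
the past. -/
theorem ae_exists_iterZ_neg_mem [IsFiniteMeasure ν] (hP : Ergodic P ν) {C : Set Ω}
    (hC : MeasurableSet C) (h0 : ν C ≠ 0) : ∀ᵐ x ∂ν, ∃ i : ℕ, iterZ P (-i) x ∈ C := by
  have hE : MeasurableSet {x | ∃ i : ℕ, iterZ P (-i) x ∈ C} := by
    rw [ofPred_exists]
    exact MeasurableSet.iUnion fun i => measurable_iterZ P _ hC
  -- The set of points with a past visit contains its preimage under `P.symm`; in finite measure,
  -- ergodicity makes it null or conull, and it contains `C`.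
  rcases hP.symm.ae_empty_or_univ_of_preimage_ae_le hE.nullMeasurableSet
    (LE.le.eventuallyLE (by
      rintro x ⟨i, hi⟩
      refine ⟨i + 1, ?_⟩
      rw [← iterZ_neg_one P x, ← iterZ_add] at hi
      push_cast
      rwa [neg_add])) with h | h
  · have hsub : C ⊆ {x | ∃ i : ℕ, iterZ P (-i) x ∈ C} := fun x hx =>
      ⟨0, by simpa [iterZ_zero] using hx⟩
    exact absurd (measure_mono_null hsub (ae_eq_empty.1 h)) h0
  · exact eventuallyEq_univ.1 h

/-- If no translate of `B` meets `A` then one of the two sets is null. -/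
theorem measure_eq_zero_or_of_forall_iterZ_notMem [IsFiniteMeasure ν] (hP : Ergodic P ν)
    {A B : Set Ω} (hB : MeasurableSet B)
    (h : ∀ k : ℤ, ∀ x ∈ A, iterZ P k x ∉ B) : ν A = 0 ∨ ν B = 0 := by
  by_cases h0 : ν B = 0
  · exact Or.inr h0
  · refine Or.inl (measure_mono_null (fun x hx => ?_) (ae_exists_iterZ_neg_mem hP hB h0))
    rintro ⟨i, hi⟩
    exact h _ x hx hi

/-- A countable disjoint family of measurable sets admits a measurable index function. -/
theorem exists_measurable_index {ι : Type*} [Countable ι] [Nonempty ι] [MeasurableSpace ι]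
    [MeasurableSingletonClass ι] {X : ι → Set Ω} (hX : ∀ i, MeasurableSet (X i))
    (hd : Pairwise (fun i j => Disjoint (X i) (X j))) :
    ∃ idx : Ω → ι, Measurable idx ∧ ∀ i, ∀ x ∈ X i, idx x = i := by
  classical
  obtain ⟨i₀⟩ := ‹Nonempty ι›
  have huniq : ∀ x i j, x ∈ X i → x ∈ X j → i = j := fun x i j hi hj => by
    by_contra hne
    exact (Set.disjoint_left.1 (hd hne)) hi hj
  let idx : Ω → ι := fun x => if h : ∃ i, x ∈ X i then h.choose else i₀
  have hidx : ∀ i, ∀ x ∈ X i, idx x = i := fun i x hx => by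
    have h : ∃ i, x ∈ X i := ⟨i, hx⟩
    simp only [idx, dif_pos h]
    exact huniq x _ _ h.choose_spec hx
  refine ⟨idx, measurable_to_countable' fun i => ?_, hidx⟩
  have : idx ⁻¹' {i} = X i ∪ ((⋃ j, X j)ᶜ ∩ {_x | i = i₀}) := by
    ext x
    simp only [mem_preimage, mem_singleton_iff, mem_union, mem_inter_iff, mem_compl_iff,
      mem_iUnion]
    constructor
    · intro hx
      by_cases h : ∃ j, x ∈ X j
      · obtain ⟨j, hj⟩ := h
        rw [hidx j x hj] at hx
        exact Or.inl (hx ▸ hj)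
      · refine Or.inr ⟨h, ?_⟩
        simp only [idx, dif_neg h] at hx
        exact hx.symm
    · rintro (hx | ⟨h, rfl⟩)
      · exact hidx i x hx
      · simp only [idx, dif_neg h]
  rw [this]
  exact (hX i).union ((MeasurableSet.iUnion hX).compl.inter (MeasurableSet.const _))

/-- Two sets of equal measure are related, up to null sets, by a piecewise iterate of a given
ergodic transformation. -/
theorem exists_piecewise_iterate [IsFiniteMeasure ν] (hP : Ergodic P ν) {A B : Set Ω}
    (hA : MeasurableSet A) (hB : MeasurableSet B) (hAB : ν A = ν B) :
    ∃ h : Ω → Ω, Measurable h ∧ (∀ x, ∃ k : ℤ, h x = iterZ P k x) ∧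
      (ν.restrict A).map h = ν.restrict B ∧
      ∃ G ⊆ A, MeasurableSet G ∧ ν (A \ G) = 0 ∧ InjOn h G := by
  obtain ⟨κ, hκ⟩ := exists_surjective_nat ℤ
  -- Greedy exhaustion: at time `n`, whatever remains of `A` and is sent by the iterate `κ n` into
  -- what remains of `B` is matched and removed from both. Repetitions in the enumeration are
  -- harmless.
  let step : ℕ → Set Ω × Set Ω → Set Ω × Set Ω := fun n p =>
    (p.1 \ iterZ P (κ n) ⁻¹' p.2, p.2 \ iterZ P (-κ n) ⁻¹' p.1)
  let R : ℕ → Set Ω × Set Ω := fun n => Nat.rec (A, B) step n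
  have hR1 : ∀ n, (R (n + 1)).1 = (R n).1 \ iterZ P (κ n) ⁻¹' (R n).2 := fun n => rfl
  have hR2 : ∀ n, (R (n + 1)).2 = (R n).2 \ iterZ P (-κ n) ⁻¹' (R n).1 := fun n => rfl
  have hRm : ∀ n, MeasurableSet (R n).1 ∧ MeasurableSet (R n).2 := by
    intro n
    induction n with
    | zero => exact ⟨hA, hB⟩
    | succ n ih =>
      exact ⟨by rw [hR1]; exact ih.1.diff (measurable_iterZ P _ ih.2),
        by rw [hR2]; exact ih.2.diff (measurable_iterZ P _ ih.1)⟩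
  have hanti1 : Antitone fun n => (R n).1 :=
    antitone_nat_of_succ_le fun n => by rw [hR1]; exact sdiff_subset
  have hanti2 : Antitone fun n => (R n).2 :=
    antitone_nat_of_succ_le fun n => by rw [hR2]; exact sdiff_subset
  let C : ℕ → Set Ω := fun n => (R n).1 ∩ iterZ P (κ n) ⁻¹' (R n).2
  let D : ℕ → Set Ω := fun n => (R n).2 ∩ iterZ P (-κ n) ⁻¹' (R n).1
  have hCm : ∀ n, MeasurableSet (C n) := fun n => (hRm n).1.inter (measurable_iterZ P _ (hRm n).2)
  have hDm : ∀ n, MeasurableSet (D n) := fun n => (hRm n).2.inter (measurable_iterZ P _ (hRm n).1)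
  have hCA : ∀ n, C n ⊆ A := fun n => inter_subset_left.trans (hanti1 (Nat.zero_le n))
  have hDB : ∀ n, D n ⊆ B := fun n => inter_subset_left.trans (hanti2 (Nat.zero_le n))
  have hCD : ∀ n, C n = iterZ P (κ n) ⁻¹' D n := by
    intro n; ext x
    simp only [C, D, mem_inter_iff, mem_preimage, iterZ_neg_apply]
    exact and_comm
  have hCd : Pairwise fun i j => Disjoint (C i) (C j) := by
    refine (pairwise_disjoint_on C).2 fun m n hmn => disjoint_left.2 fun x hx hx' => ?_
    have : x ∈ (R (m + 1)).1 := hanti1 hmn hx'.1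
    rw [hR1] at this
    exact this.2 hx.2
  have hDd : Pairwise fun i j => Disjoint (D i) (D j) := by
    refine (pairwise_disjoint_on D).2 fun m n hmn => disjoint_left.2 fun x hx hx' => ?_
    have : x ∈ (R (m + 1)).2 := hanti2 hmn hx'.1
    rw [hR2] at this
    exact this.2 hx.2
  have hνCD : ∀ n, ν (C n) = ν (D n) := fun n => by
    rw [hCD]; exact measure_preimage_iterZ hP.toMeasurePreserving _ (hDm n)
  have hleft1 : A \ ⋃ n, C n ⊆ ⋂ n, (R n).1 := by
    rintro x ⟨hxA, hx⟩
    refine mem_iInter.2 fun n => ?_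
    induction n with
    | zero => exact hxA
    | succ n ih => rw [hR1]; exact ⟨ih, fun h => hx (mem_iUnion.2 ⟨n, ih, h⟩)⟩
  have hleft2 : B \ ⋃ n, D n ⊆ ⋂ n, (R n).2 := by
    rintro x ⟨hxB, hx⟩
    refine mem_iInter.2 fun n => ?_
    induction n with
    | zero => exact hxB
    | succ n ih => rw [hR2]; exact ⟨ih, fun h => hx (mem_iUnion.2 ⟨n, ih, h⟩)⟩
  have hCu : MeasurableSet (⋃ n, C n) := MeasurableSet.iUnion hCm
  have hDu : MeasurableSet (⋃ n, D n) := MeasurableSet.iUnion hDm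
  have hUeq : ν (⋃ n, C n) = ν (⋃ n, D n) := by
    rw [measure_iUnion hCd hCm, measure_iUnion hDd hDm]
    exact tsum_congr hνCD
  have hrem : ν (A \ ⋃ n, C n) = ν (B \ ⋃ n, D n) := by
    rw [measure_sdiff (iUnion_subset hCA) hCu.nullMeasurableSet (measure_ne_top _ _),
      measure_sdiff (iUnion_subset hDB) hDu.nullMeasurableSet (measure_ne_top _ _), hUeq, hAB]
  -- No iterate sends a leftover of `A` to a leftover of `B`, so ergodicity makes one of them null;
  -- having equal measure, both are.
  have hnull : ν (A \ ⋃ n, C n) = 0 := by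
    have := measure_eq_zero_or_of_forall_iterZ_notMem hP (A := A \ ⋃ n, C n) (hB.diff hDu)
      (fun k x hx hk => by
        obtain ⟨n, rfl⟩ := hκ k
        exact hx.2 (mem_iUnion.2 ⟨n, mem_iInter.1 (hleft1 hx) n, mem_iInter.1 (hleft2 hk) n⟩))
    rcases this with h | h
    · exact h
    · rw [hrem, h]
  obtain ⟨idx, hidx, hidxC⟩ := exists_measurable_index hCm hCd
  have hh : Measurable fun x => iterZ P (κ (idx x)) x :=
    (measurable_from_prod_countable_right (f := fun p : ℕ × Ω => iterZ P (κ p.1) p.2)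
      fun n => measurable_iterZ P (κ n)).comp (hidx.prodMk measurable_id)
  refine ⟨_, hh, fun x => ⟨_, rfl⟩, ?_, ⋃ n, C n, iUnion_subset hCA, hCu, hnull, ?_⟩
  · ext E hE
    rw [Measure.map_apply hh hE, Measure.restrict_apply (hh hE), Measure.restrict_apply hE]
    have e1 : ν ((fun x => iterZ P (κ (idx x)) x) ⁻¹' E ∩ A) =
        ν (⋃ n, iterZ P (κ n) ⁻¹' (E ∩ D n)) := by
      refine measure_congr ?_
      have hae : ∀ᵐ x ∂ν, x ∉ A \ ⋃ n, C n := measure_eq_zero_iff_ae_notMem.1 hnull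
      filter_upwards [hae] with x hx
      refine propext (?_ : _ ↔ _)
      constructor
      · rintro ⟨h1, h2⟩
        obtain ⟨n, hn⟩ := mem_iUnion.1 (not_not.1 fun h => hx ⟨h2, h⟩)
        refine mem_iUnion.2 ⟨n, ?_, ?_⟩
        · have := hidxC n x hn
          simpa only [mem_preimage, this] using h1
        · rw [hCD] at hn; exact hn
      · intro h
        obtain ⟨n, h1, h2⟩ := mem_iUnion.1 h
        have hn : x ∈ C n := by rw [hCD]; exact h2
        refine ⟨?_, hCA n hn⟩
        simpa only [mem_preimage, hidxC n x hn] using h1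
    have e2 : ν (E ∩ B) = ν (⋃ n, E ∩ D n) := by
      rw [← inter_iUnion]
      refine measure_congr ?_
      have hae : ∀ᵐ x ∂ν, x ∉ B \ ⋃ n, D n := measure_eq_zero_iff_ae_notMem.1 (hrem ▸ hnull)
      filter_upwards [hae] with x hx
      refine propext (?_ : _ ↔ _)
      constructor
      · rintro ⟨h1, h2⟩
        exact ⟨h1, not_not.1 fun h => hx ⟨h2, h⟩⟩
      · rintro ⟨h1, h2⟩
        exact ⟨h1, iUnion_subset hDB h2⟩
    rw [e1, e2, measure_iUnion, measure_iUnion]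
    · exact tsum_congr fun n =>
        measure_preimage_iterZ hP.toMeasurePreserving _ (hE.inter (hDm n))
    · exact fun i j hij => (hDd hij).mono inter_subset_right inter_subset_right
    · exact fun n => hE.inter (hDm n)
    · intro i j hij
      refine (hCd hij).mono ?_ ?_
      · rw [hCD i]; exact preimage_mono inter_subset_right
      · rw [hCD j]; exact preimage_mono inter_subset_right
    · exact fun n => measurable_iterZ P _ (hE.inter (hDm n))
  · intro x hx y hy hxy
    obtain ⟨m, hm⟩ := mem_iUnion.1 hx
    obtain ⟨n, hn⟩ := mem_iUnion.1 hy
    simp only [hidxC m x hm, hidxC n y hn] at hxy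
    have h1 : iterZ P (κ m) x ∈ D m := by rw [hCD] at hm; exact hm
    have h2 : iterZ P (κ n) y ∈ D n := by rw [hCD] at hn; exact hn
    have hmn : m = n := by
      by_contra hne
      exact disjoint_left.1 (hDd hne) h1 (hxy ▸ h2)
    subst hmn
    exact iterZ_injective P _ hxy

end Iterates

/-! ### Dyadic arrays and their composition -/

section Arrays

variable {Ω : Type*} [MeasurableSpace Ω]

/-- A dyadic array of order `k` on `A` over the base `A'`: a labelling of `A` by `2 ^ k` labels
together with a projection to `A'` moving points along the orbits of `P`, which maps each label
class isomorphically (mod 0) onto `A'`. -/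
structure IsArray (P : Ω ≃ᵐ Ω) (ν : Measure Ω) (A A' : Set Ω) (k : ℕ) (e : Ω → ℕ)
    (π : Ω → Ω) : Prop where
  measurableSet : MeasurableSet A
  measurableSet_base : MeasurableSet A'
  measurable_label : Measurable e
  measurable_proj : Measurable π
  label_lt : ∀ x, e x < 2 ^ k
  orbit : ∀ x, ∃ j : ℤ, π x = iterZ P j x
  map_eq : ∀ s < 2 ^ k, (ν.restrict (A ∩ e ⁻¹' {s})).map π = ν.restrict A'
  inj : ∃ G ⊆ A, MeasurableSet G ∧ ν (A \ G) = 0 ∧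
    ∀ x ∈ G, ∀ y ∈ G, e x = e y → π x = π y → x = y

namespace IsArray

variable {P : Ω ≃ᵐ Ω} {ν : Measure Ω} {A A' A'' : Set Ω} {k k' : ℕ} {e e' : Ω → ℕ} {π π' : Ω → Ω}

theorem measure_inter_preimage (h : IsArray P ν A A' k e π) {s : ℕ} (hs : s < 2 ^ k) {E : Set Ω}
    (hE : MeasurableSet E) : ν (A ∩ e ⁻¹' {s} ∩ π ⁻¹' E) = ν (A' ∩ E) := by
  have := congrArg (fun ρ => ρ E) (h.map_eq s hs)
  simp only [Measure.map_apply h.measurable_proj hE,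
    Measure.restrict_apply (h.measurable_proj hE), Measure.restrict_apply hE] at this
  rw [inter_comm, this, inter_comm]

theorem measure_label (h : IsArray P ν A A' k e π) {s : ℕ} (hs : s < 2 ^ k) :
    ν (A ∩ e ⁻¹' {s}) = ν A' := by
  simpa using h.measure_inter_preimage hs MeasurableSet.univ

/-- Each of the `2 ^ k` label classes contributes one copy of the base. This factor is why errors on
the base must be chosen `2 ^ k` times smaller. -/
theorem measure_preimage (h : IsArray P ν A A' k e π) {E : Set Ω} (hE : MeasurableSet E) :
    ν (A ∩ π ⁻¹' E) = 2 ^ k * ν (A' ∩ E) := by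
  have hU : A ∩ π ⁻¹' E = ⋃ s : Fin (2 ^ k), A ∩ e ⁻¹' {(s : ℕ)} ∩ π ⁻¹' E := by
    ext x
    simp only [mem_inter_iff, mem_preimage, mem_iUnion, mem_singleton_iff]
    exact ⟨fun hx => ⟨⟨e x, h.label_lt x⟩, ⟨hx.1, rfl⟩, hx.2⟩, fun ⟨_, hx⟩ => ⟨hx.1.1, hx.2⟩⟩
  rw [hU, measure_iUnion]
  · rw [tsum_fintype, Finset.sum_congr rfl fun s _ => h.measure_inter_preimage s.2 hE]
    simp
  · intro s t hst
    refine disjoint_left.2 fun x hx hx' => hst (Fin.ext ?_)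
    exact hx.1.2.symm.trans hx'.1.2
  · exact fun s => (h.measurableSet.inter (h.measurable_label (measurableSet_singleton _))).inter
      (h.measurable_proj hE)

theorem measure_eq (h : IsArray P ν A A' k e π) : ν A = 2 ^ k * ν A' := by
  simpa using h.measure_preimage MeasurableSet.univ

theorem ae_proj_mem (h : IsArray P ν A A' k e π) : ∀ᵐ x ∂ν, x ∈ A → π x ∈ A' := by
  have := h.measure_preimage h.measurableSet_base.compl
  rw [inter_compl_self, measure_empty, mul_zero] at this
  filter_upwards [measure_eq_zero_iff_ae_notMem.1 this] with x hx hA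
  by_contra hcon
  exact hx ⟨hA, hcon⟩

theorem refl (P : Ω ≃ᵐ Ω) (ν : Measure Ω) (hA : MeasurableSet A) :
    IsArray P ν A A 0 (fun _ => 0) id where
  measurableSet := hA
  measurableSet_base := hA
  measurable_label := measurable_const
  measurable_proj := measurable_id
  label_lt _ := by simp
  orbit x := ⟨0, (iterZ_zero P x).symm⟩
  map_eq s hs := by
    obtain rfl : s = 0 := by simpa using hs
    simp
  inj := ⟨A, subset_rfl, hA, by simp, fun _ _ _ _ _ h => h⟩

/-- The labels concatenate in binary: the old label supplies the low `k` bits and the label of the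
projected point the next `k'`. Digits already assigned are therefore never altered by refinement,
and quotient and remainder by `2 ^ k` recover both labels. -/
theorem comp (h : IsArray P ν A A' k e π) (h' : IsArray P ν A' A'' k' e' π') :
    IsArray P ν A A'' (k + k') (fun x => e x + 2 ^ k * e' (π x)) (π' ∘ π) where
  measurableSet := h.measurableSet
  measurableSet_base := h'.measurableSet_base
  measurable_label := h.measurable_label.add
    ((h'.measurable_label.comp h.measurable_proj).const_mul _)
  measurable_proj := h'.measurable_proj.comp h.measurable_proj
  label_lt x := by
    have h1 := h.label_lt x
    have h2 := h'.label_lt (π x)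
    calc e x + 2 ^ k * e' (π x) < 2 ^ k + 2 ^ k * e' (π x) := by omega
      _ = 2 ^ k * (e' (π x) + 1) := by ring
      _ ≤ 2 ^ k * 2 ^ k' := Nat.mul_le_mul_left _ h2
      _ = 2 ^ (k + k') := (pow_add _ _ _).symm
  orbit x := by
    obtain ⟨i, hi⟩ := h.orbit x
    obtain ⟨j, hj⟩ := h'.orbit (π x)
    exact ⟨j + i, by rw [iterZ_add, ← hi, ← hj, Function.comp_apply]⟩
  map_eq s hs := by
    have hk : 0 < 2 ^ k := by positivity
    have h1 : s % 2 ^ k < 2 ^ k := Nat.mod_lt _ hk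
    have h2 : s / 2 ^ k < 2 ^ k' := Nat.div_lt_of_lt_mul (by rwa [← pow_add])
    have hset : A ∩ (fun x => e x + 2 ^ k * e' (π x)) ⁻¹' {s} =
        π ⁻¹' (e' ⁻¹' {s / 2 ^ k}) ∩ (A ∩ e ⁻¹' {s % 2 ^ k}) := by
      ext x
      have hx := h.label_lt x
      simp only [mem_inter_iff, mem_preimage, mem_singleton_iff]
      constructor
      · rintro ⟨hA, rfl⟩
        refine ⟨?_, hA, ?_⟩
        · rw [Nat.add_mul_div_left _ _ hk, Nat.div_eq_of_lt hx, zero_add]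
        · rw [Nat.add_mul_mod_self_left, Nat.mod_eq_of_lt hx]
      · rintro ⟨hx2, hA, hx1⟩
        exact ⟨hA, by rw [hx1, hx2, Nat.mod_add_div]⟩
    have hm : MeasurableSet (e' ⁻¹' {s / 2 ^ k}) := h'.measurable_label (measurableSet_singleton _)
    rw [hset, ← Measure.restrict_restrict (h.measurable_proj hm),
      ← Measure.map_map h'.measurable_proj h.measurable_proj,
      ← Measure.restrict_map h.measurable_proj hm, h.map_eq _ h1, Measure.restrict_restrict hm,
      inter_comm, h'.map_eq _ h2]
  inj := by
    obtain ⟨G, hGA, hG, hG0, hinj⟩ := h.inj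
    obtain ⟨G', hGA', hG', hG0', hinj'⟩ := h'.inj
    refine ⟨G ∩ π ⁻¹' G', inter_subset_left.trans hGA, hG.inter (h.measurable_proj hG'), ?_, ?_⟩
    · have hz : ν (A ∩ π ⁻¹' G'ᶜ) = 0 := by
        rw [h.measure_preimage hG'.compl, ← sdiff_eq, hG0', mul_zero]
      refine measure_mono_null (t := (A \ G) ∪ (A ∩ π ⁻¹' G'ᶜ)) ?_ (measure_union_null hG0 hz)
      rintro x ⟨hA, hx⟩
      by_cases hxG : x ∈ G
      · exact Or.inr ⟨hA, fun hc => hx ⟨hxG, hc⟩⟩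
      · exact Or.inl ⟨hA, hxG⟩
    · rintro x ⟨hxG, hx'⟩ y ⟨hyG, hy'⟩ hexy hπxy
      have hk : 0 < 2 ^ k := by positivity
      have hmod := congrArg (· % 2 ^ k) hexy
      have hdiv := congrArg (· / 2 ^ k) hexy
      simp only [Nat.add_mul_mod_self_left, Nat.mod_eq_of_lt (h.label_lt _)] at hmod
      simp only [Nat.add_mul_div_left _ _ hk, Nat.div_eq_of_lt (h.label_lt _), zero_add] at hdiv
      exact hinj x hxG y hyG hmod (hinj' _ hx' _ hy' hdiv hπxy)

/-- An array can be assembled from pieces, each of them mapped onto the base. -/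
theorem exists_of_pieces (hA' : MeasurableSet A') {X : Fin (2 ^ k) → Set Ω}
    (hX : ∀ i, MeasurableSet (X i)) (hd : Pairwise fun i j => Disjoint (X i) (X j))
    {g : Fin (2 ^ k) → Ω → Ω} (hg : ∀ i, Measurable (g i))
    (horb : ∀ i x, ∃ j : ℤ, g i x = iterZ P j x)
    (hmap : ∀ i, (ν.restrict (X i)).map (g i) = ν.restrict A')
    (hinj : ∀ i, ∃ G ⊆ X i, MeasurableSet G ∧ ν (X i \ G) = 0 ∧ InjOn (g i) G) :
    ∃ e π, IsArray P ν (⋃ i, X i) A' k e π ∧ ∀ i, ∀ x ∈ X i, e x = i ∧ π x = g i x := by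
  have : Nonempty (Fin (2 ^ k)) := ⟨⟨0, by positivity⟩⟩
  obtain ⟨idx, hidx, hidxX⟩ := exists_measurable_index hX hd
  have hπ : Measurable fun x => g (idx x) x :=
    (measurable_from_prod_countable_right (f := fun p : Fin (2 ^ k) × Ω => g p.1 p.2)
      fun n => hg n).comp (hidx.prodMk measurable_id)
  choose G hGX hG hG0 hGinj using hinj
  refine ⟨fun x => idx x, fun x => g (idx x) x, ?_, fun i x hx => by simp only [hidxX i x hx, and_self]⟩
  refine ⟨MeasurableSet.iUnion hX, hA', (measurable_of_countable _).comp hidx, hπ,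
    fun x => (idx x).2, fun x => horb _ x, fun s hs => ?_, ⋃ i, G i,
    iUnion_mono hGX, MeasurableSet.iUnion hG, ?_, ?_⟩
  · have hset : (⋃ i, X i) ∩ (fun x => ((idx x : Fin (2 ^ k)) : ℕ)) ⁻¹' {s} = X ⟨s, hs⟩ := by
      ext x
      simp only [mem_inter_iff, mem_iUnion, mem_preimage, mem_singleton_iff]
      constructor
      · rintro ⟨⟨i, hi⟩, hx⟩
        have : i = ⟨s, hs⟩ := Fin.ext (by rw [← hidxX i x hi]; exact hx)
        exact this ▸ hi
      · exact fun hx => ⟨⟨_, hx⟩, by rw [hidxX _ x hx]⟩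
    rw [hset, ← hmap ⟨s, hs⟩]
    refine Measure.map_congr ((ae_restrict_iff' (hX _)).2 (ae_of_all _ fun x hx => ?_))
    simp only [hidxX _ x hx]
  · refine measure_mono_null (t := ⋃ i, X i \ G i) ?_ (measure_iUnion_null hG0)
    rintro x ⟨hx, hxG⟩
    obtain ⟨i, hi⟩ := mem_iUnion.1 hx
    exact mem_iUnion.2 ⟨i, hi, fun h => hxG (mem_iUnion.2 ⟨i, h⟩)⟩
  · intro x hx y hy hexy hπxy
    obtain ⟨i, hi⟩ := mem_iUnion.1 hx
    obtain ⟨j, hj⟩ := mem_iUnion.1 hy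
    have hij : i = j := by
      have := Fin.ext hexy
      rwa [hidxX i x (hGX i hi), hidxX j y (hGX j hj)] at this
    subst hij
    simp only [hidxX i x (hGX i hi), hidxX i y (hGX i hj)] at hπxy
    exact hGinj i hi hj hπxy

/-- An array on a conull subset is an array on the whole set. -/
theorem of_conull {A₀ : Set Ω} (h : IsArray P ν A₀ A' k e π) (hA : MeasurableSet A) (hsub : A₀ ⊆ A)
    (h0 : ν (A \ A₀) = 0) : IsArray P ν A A' k e π := by
  obtain ⟨G, hGA, hG, hG0, hinj⟩ := h.inj
  refine ⟨hA, h.measurableSet_base, h.measurable_label, h.measurable_proj, h.label_lt, h.orbit,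
    fun s hs => ?_, G, hGA.trans hsub, hG, ?_, hinj⟩
  · rw [← h.map_eq s hs]
    congr 1
    refine Measure.restrict_congr_set ?_
    filter_upwards [measure_eq_zero_iff_ae_notMem.1 h0] with x hx
    exact propext ⟨fun hx' => ⟨not_not.1 fun hc => hx ⟨hx'.1, hc⟩, hx'.2⟩,
      fun hx' => ⟨hsub hx'.1, hx'.2⟩⟩
  · refine measure_mono_null (t := (A \ A₀) ∪ (A₀ \ G)) ?_ (measure_union_null h0 hG0)
    rintro x ⟨hxA, hxG⟩
    by_cases hx : x ∈ A₀
    · exact Or.inr ⟨hx, hxG⟩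
    · exact Or.inl ⟨hxA, hx⟩

/-- An array can be assembled from pieces indexed by an arbitrary finite type, each of them
mapped onto the base. -/
theorem exists_of_fintype_pieces {Λ : Type*} [Fintype Λ] (hΛ : Fintype.card Λ = 2 ^ k)
    (hA : MeasurableSet A) (hA' : MeasurableSet A') {X : Λ → Set Ω}
    (hX : ∀ i, MeasurableSet (X i)) (hd : Pairwise fun i j => Disjoint (X i) (X j))
    (hXA : ∀ i, X i ⊆ A) (hX0 : ν (A \ ⋃ i, X i) = 0)
    {g : Λ → Ω → Ω} (hg : ∀ i, Measurable (g i))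
    (horb : ∀ i x, ∃ j : ℤ, g i x = iterZ P j x)
    (hmap : ∀ i, (ν.restrict (X i)).map (g i) = ν.restrict A')
    (hinj : ∀ i, ∃ G ⊆ X i, MeasurableSet G ∧ ν (X i \ G) = 0 ∧ InjOn (g i) G) :
    ∃ e π, IsArray P ν A A' k e π ∧
      ∃ lab : Λ → ℕ, Function.Injective lab ∧ ∀ i, ∀ x ∈ X i, e x = lab i ∧ π x = g i x := by
  let f : Λ ≃ Fin (2 ^ k) := Fintype.equivFinOfCardEq hΛ
  obtain ⟨e, π, h, hX'⟩ := exists_of_pieces (P := P) (ν := ν) hA' (X := fun i => X (f.symm i))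
    (fun i => hX _) (fun i j hij => hd (f.symm.injective.ne hij)) (g := fun i => g (f.symm i))
    (fun i => hg _) (fun i => horb _) (fun i => hmap _) (fun i => hinj _)
  have hU : ⋃ i, X (f.symm i) = ⋃ i, X i := f.symm.surjective.iUnion_comp X
  rw [hU] at h
  refine ⟨e, π, h.of_conull hA (iUnion_subset hXA) hX0, fun i => f i,
    Fin.val_injective.comp f.injective, fun i x hx => ?_⟩
  have := hX' (f i) x (by simpa using hx)
  simpa using this

end IsArray

end Arrays

/-! ### Towers over a base set and the arrays they give -/

section Towers

variable {Ω : Type*} [MeasurableSpace Ω] {P : Ω ≃ᵐ Ω} {ν : Measure Ω}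

/-- The points of `C` which do not return to `C` within `j` steps. -/
def noReturn (P : Ω ≃ᵐ Ω) (C : Set Ω) (j : ℕ) : Set Ω :=
  {c | c ∈ C ∧ ∀ i : ℕ, 0 < i → i ≤ j → iterZ P i c ∉ C}

theorem measurableSet_noReturn {C : Set Ω} (hC : MeasurableSet C) (j : ℕ) :
    MeasurableSet (noReturn P C j) := by
  have : noReturn P C j = C ∩ ⋂ (i : ℕ) (_ : 0 < i) (_ : i ≤ j), iterZ P i ⁻¹' Cᶜ := by
    ext x; simp [noReturn]
  rw [this]
  exact hC.inter (MeasurableSet.iInter fun i => MeasurableSet.iInter fun _ =>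
    MeasurableSet.iInter fun _ => measurable_iterZ P _ hC.compl)

/-- With `j < j'`, the point `c'` would reach `c ∈ C` after `j' - j` steps, a forbidden early
return. Hence distinct levels of the tower are disjoint and each point has a unique base point. -/
theorem noReturn_unique {C : Set Ω} {j j' : ℕ} {c c' : Ω} (hc : c ∈ noReturn P C j)
    (hc' : c' ∈ noReturn P C j') (h : iterZ P j c = iterZ P j' c') : j = j' ∧ c = c' := by
  have key : ∀ {j j' : ℕ} {c c' : Ω}, c ∈ noReturn P C j → c' ∈ noReturn P C j' →
      iterZ P j c = iterZ P j' c' → j' ≤ j := by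
    intro j j' c c' hc hc' h
    by_contra hlt
    refine hc'.2 (j' - j) (by omega) (by omega) ?_
    have : iterZ P ((j' - j : ℕ) : ℤ) c' = c := by
      have hj : ((j' - j : ℕ) : ℤ) = -j + j' := by omega
      rw [hj, iterZ_add, ← h, iterZ_neg_apply]
    rw [this]; exact hc.1
  have hj : j = j' := le_antisymm (key hc' hc h.symm) (key hc hc' h)
  subst hj
  exact ⟨rfl, iterZ_injective P _ h⟩

/-- Every point with a visit to `C` less than `H` steps ago lies on a level below `H` of the
tower over `C`. -/
theorem exists_mem_noReturn {C : Set Ω} {H : ℕ} {x : Ω} (h : ∃ i < H, iterZ P (-(i : ℕ)) x ∈ C) :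
    ∃ j < H, iterZ P (-(j : ℕ)) x ∈ noReturn P C j := by
  classical
  have h' : ∃ i : ℕ, iterZ P (-(i : ℕ)) x ∈ C := h.imp fun i hi => hi.2
  obtain ⟨i, hiH, hi⟩ := h
  refine ⟨Nat.find h', (Nat.find_min' h' hi).trans_lt hiH, Nat.find_spec h', fun l hl hle hcon => ?_⟩
  refine Nat.find_min h' (m := Nat.find h' - l) (by omega) ?_
  have : (-((Nat.find h' - l : ℕ) : ℤ)) = l + -(Nat.find h' : ℤ) := by omega
  rw [this, iterZ_add]
  exact hcon

/-- The sets decrease with `H` to the points with no visit to `C` in their past, a null set by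
ergodicity. -/
theorem exists_height [IsFiniteMeasure ν] (hP : Ergodic P ν) {C : Set Ω} (hC : MeasurableSet C)
    (hC0 : ν C ≠ 0) {δ : ℝ≥0∞} (hδ : δ ≠ 0) :
    ∃ H : ℕ, ν {x | ∀ i < H, iterZ P (-(i : ℕ)) x ∉ C} ≤ δ := by
  have hm : ∀ H : ℕ, MeasurableSet {x | ∀ i < H, iterZ P (-(i : ℕ)) x ∉ C} := fun H => by
    have : {x | ∀ i < H, iterZ P (-(i : ℕ)) x ∉ C} =
        ⋂ (i : ℕ) (_ : i < H), iterZ P (-(i : ℕ)) ⁻¹' Cᶜ := by ext x; simp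
    rw [this]
    exact MeasurableSet.iInter fun i => MeasurableSet.iInter fun _ => measurable_iterZ P _ hC.compl
  have h := tendsto_measure_iInter_atTop (μ := ν) (fun H => (hm H).nullMeasurableSet)
    (fun a b hab x hx i hi => hx i (lt_of_lt_of_le hi hab)) ⟨0, measure_ne_top _ _⟩
  have h0 : ν (⋂ H : ℕ, {x | ∀ i < H, iterZ P (-(i : ℕ)) x ∉ C}) = 0 := by
    rw [measure_eq_zero_iff_ae_notMem]
    filter_upwards [ae_exists_iterZ_neg_mem hP hC hC0] with x hx hcon
    obtain ⟨i, hi⟩ := hx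
    exact mem_iInter.1 hcon (i + 1) i (Nat.lt_succ_self i) hi
  rw [h0] at h
  obtain ⟨H, hH⟩ := (h.eventually (Iio_mem_nhds (pos_iff_ne_zero.2 hδ))).exists
  exact ⟨H, le_of_lt hH⟩

theorem exists_le_two_pow_mul {c δ : ℝ≥0∞} (hc : c ≠ ∞) (hδ : δ ≠ 0) :
    ∃ k ≥ 1, c ≤ 2 ^ k * δ := by
  obtain ⟨n, hn⟩ := ENNReal.exists_nat_mul_gt hδ hc
  refine ⟨n + 1, by omega, hn.le.trans ?_⟩
  gcongr
  have : n ≤ 2 ^ (n + 1) := (Nat.lt_two_pow_self).le.trans (Nat.pow_le_pow_right (by norm_num) (by omega))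
  exact_mod_cast this

variable [StandardBorelSpace Ω]

/-- An array on `A` whose projection is constant on most of each segment between successive
visits to `C`, and whose label determines the colouring `b` off a small set. -/
theorem exists_array_of_tower [IsFiniteMeasure ν] [NullSingletonClass ν] (hP : Ergodic P ν)
    {A C : Set Ω} (hA : MeasurableSet A) (hC : MeasurableSet C) (hCA : C ⊆ A) (hC0 : ν C ≠ 0)
    {T : Type*} [Fintype T] [MeasurableSpace T] [MeasurableSingletonClass T] {b : Ω → T}
    (hb : Measurable b) {δ : ℝ≥0∞} (hδ : δ ≠ 0) :
    ∃ k ≥ 1, ∃ A' e π, IsArray P ν A A' k e π ∧ ∃ D, MeasurableSet D ∧ ν D ≤ δ ∧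
      (∀ x ∈ A \ D, ∀ m : ℕ, iterZ P m x ∈ A \ D →
        (∀ l : ℕ, 0 < l → l ≤ m → iterZ P l x ∉ C) → π (iterZ P m x) = π x) ∧
      (∀ x ∈ A \ D, ∀ y ∈ A \ D, e x = e y → b x = b y) := by
  classical
  have hδ2 : δ / 2 ≠ 0 := (ENNReal.half_pos hδ).ne'
  obtain ⟨H, hH⟩ := exists_height hP hC hC0 hδ2
  -- The colour of a base point records, for every height `j < H`, whether the point above it is a
  -- genuine tower point in `A`, and its `b`-colour. Over a `τ`-monochromatic set every level is
  -- then wholly used or unused, and `b` is constant on it.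
  let τ : Ω → Fin H → Bool × T := fun x j =>
    (decide (x ∈ noReturn P C j ∧ iterZ P (j : ℕ) x ∈ A), b (iterZ P (j : ℕ) x))
  have hlev : ∀ j : Fin H, MeasurableSet {x | x ∈ noReturn P C j ∧ iterZ P (j : ℕ) x ∈ A} :=
    fun j => (measurableSet_noReturn hC j).inter (measurable_iterZ P _ hA)
  have hτ : Measurable τ := by
    refine measurable_pi_lambda _ fun j => Measurable.prodMk ?_ (hb.comp (measurable_iterZ P _))
    refine measurable_to_bool ?_
    have : (fun x => decide (x ∈ noReturn P C j ∧ iterZ P (j : ℕ) x ∈ A)) ⁻¹' {true} =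
        {x | x ∈ noReturn P C j ∧ iterZ P (j : ℕ) x ∈ A} := by ext x; simp
    rw [this]; exact hlev j
  set N := Fintype.card (Fin H → Bool × T) with hN
  have hA0 : ν A ≠ 0 := fun h => hC0 (measure_mono_null hCA h)
  -- The uncoloured remainder of `C` costs at most `N * q` on each of `H` levels, with `q = ν A / 2
  -- ^ k`; this `k` makes the total at most `δ / 2`. The other half of `δ` covers points above
  -- height `H`.
  obtain ⟨k, hk1, hk⟩ := exists_le_two_pow_mul (c := H * N * ν A) (δ := δ / 2)
    (ENNReal.mul_ne_top (ENNReal.mul_ne_top (by simp) (by simp)) (measure_ne_top _ _)) hδ2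
  have h2k : (2 : ℝ≥0∞) ^ k ≠ 0 := by positivity
  have h2k' : (2 : ℝ≥0∞) ^ k ≠ ∞ := ENNReal.pow_ne_top (by simp)
  set q := ν A / 2 ^ k with hqdef
  have hqA : 2 ^ k * q = ν A := ENNReal.mul_div_cancel h2k h2k'
  have hq0 : q ≠ 0 := fun h => hA0 (by rw [← hqA, h, mul_zero])
  have hqtop : q ≠ ∞ := (ENNReal.div_lt_top (measure_ne_top _ _) h2k).ne
  have hqsmall : (H : ℝ≥0∞) * (N * q) ≤ δ / 2 := by
    rw [hqdef, ← mul_assoc, ← mul_div_assoc]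
    exact ENNReal.div_le_of_le_mul' hk
  have hCq : ν C ≤ ((2 ^ k : ℕ) : ℝ≥0∞) * q := by
    push_cast; rw [hqA]; exact measure_mono hCA
  obtain ⟨r, W, t, hW, hWq, hWC, hWd, hWt, hrem⟩ :=
    exists_monochromatic_pieces hτ (q := q) (2 ^ k) C hC hCq
  let L := {p : Fin r × Fin H // (t p.1 p.2).1 = true}
  let X₀ : L → Set Ω := fun p => iterZ P (-((p.1.2 : ℕ) : ℤ)) ⁻¹' W p.1.1
  have hLmem : ∀ (i : Fin r) (j : Fin H), ∀ x ∈ W i,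
      ((t i j).1 = true ↔ x ∈ noReturn P C j ∧ iterZ P (j : ℕ) x ∈ A) := fun i j x hx => by
    rw [← hWt i x hx]; simp [τ]
  have hX₀mem : ∀ (p : L) x, x ∈ X₀ p → iterZ P (-((p.1.2 : ℕ) : ℤ)) x ∈ noReturn P C p.1.2 ∧
      x ∈ A := fun p x hx => by
    have := (hLmem p.1.1 p.1.2 _ hx).1 p.2
    rwa [iterZ_apply_neg] at this
  have hX₀ : ∀ p, MeasurableSet (X₀ p) := fun p => measurable_iterZ P _ (hW _)
  have hX₀q : ∀ p, ν (X₀ p) = q := fun p =>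
    (measure_preimage_iterZ hP.toMeasurePreserving _ (hW _)).trans (hWq _)
  have hX₀A : ∀ p, X₀ p ⊆ A := fun p x hx => (hX₀mem p x hx).2
  have hWuniq : ∀ i i' x, x ∈ W i → x ∈ W i' → i = i' := fun i i' x hi hi' => by
    by_contra hne
    exact disjoint_left.1 (hWd hne) hi hi'
  have hX₀d : Pairwise fun p p' => Disjoint (X₀ p) (X₀ p') := by
    intro p p' hne
    refine disjoint_left.2 fun x hx hx' => hne ?_
    have h1 := noReturn_unique (hX₀mem p x hx).1 (hX₀mem p' x hx').1
      (by rw [iterZ_apply_neg, iterZ_apply_neg])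
    have hj : p.1.2 = p'.1.2 := Fin.ext h1.1
    have hi : p.1.1 = p'.1.1 := hWuniq _ _ _ hx (by rw [h1.2]; exact hx')
    exact Subtype.ext (Prod.ext hi hj)
  have hX₀U : MeasurableSet (⋃ p, X₀ p) := MeasurableSet.iUnion hX₀
  have hX₀ν : ν (⋃ p, X₀ p) = Fintype.card L * q := by
    rw [measure_iUnion hX₀d hX₀, tsum_fintype]
    simp [hX₀q]
  have hLcard : Fintype.card L ≤ 2 ^ k := by
    have h1 : (Fintype.card L : ℝ≥0∞) * q ≤ 2 ^ k * q := by
      rw [← hX₀ν, hqA]; exact measure_mono (iUnion_subset hX₀A)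
    have h2 := (ENNReal.mul_le_mul_iff_left hq0 hqtop).1 h1
    exact_mod_cast h2
  have hDν : ν (A \ ⋃ p, X₀ p) = ((2 ^ k - Fintype.card L : ℕ) : ℝ≥0∞) * q := by
    rw [measure_sdiff (iUnion_subset hX₀A) hX₀U.nullMeasurableSet (measure_ne_top _ _), hX₀ν,
      ← hqA, ENNReal.natCast_sub, ENNReal.sub_mul fun _ _ => hqtop]
    push_cast; rfl
  -- The part of `A` outside the good levels has measure an exact multiple of `q`, so arbitrary
  -- pieces complete the family to `2 ^ k` classes of equal measure.
  obtain ⟨Y, hY, hYq, hYd, hYD, hY0⟩ :=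
    exists_partition_of_measure_eq q _ _ (hA.diff hX₀U) hDν
  obtain ⟨A', -, hA', hA'q⟩ := exists_subset_measure_eq (ν := ν) hA (c := q) (by
    rw [← hqA]
    exact le_mul_of_one_le_left zero_le (one_le_pow₀ (by norm_num)))
  choose hf hfm hforb hfmap hfinj using fun i =>
    exists_piecewise_iterate hP (hW i) hA' ((hWq i).trans hA'q.symm)
  choose gf gfm gforb gfmap gfinj using fun i =>
    exists_piecewise_iterate hP (hY i) hA' ((hYq i).trans hA'q.symm)
  let Λ := L ⊕ Fin (2 ^ k - Fintype.card L)
  have hΛ : Fintype.card Λ = 2 ^ k := by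
    rw [Fintype.card_sum, Fintype.card_fin]; omega
  let X : Λ → Set Ω := Sum.elim X₀ Y
  -- A level is first brought down to its column base, then mapped by the column's single map `hf`.
  -- This makes the projection constant along each column.
  let g : Λ → Ω → Ω := Sum.elim (fun p x => hf p.1.1 (iterZ P (-((p.1.2 : ℕ) : ℤ)) x)) gf
  have hYX₀ : ∀ p i, Disjoint (X₀ p) (Y i) := fun p i =>
    (disjoint_sdiff_right (s := ⋃ p, X₀ p) (t := A)).mono (subset_iUnion X₀ p) (hYD i)
  obtain ⟨e, π, harr, lab, hlab, hlabX⟩ := IsArray.exists_of_fintype_pieces (P := P) (ν := ν)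
    (A := A) (A' := A') (k := k) hΛ hA hA' (X := X) (g := g)
    (by rintro (p | i); exacts [hX₀ p, hY i])
    (by
      rintro (p | i) (p' | i') hne
      · exact hX₀d fun h => hne (by rw [h])
      · exact hYX₀ p i'
      · exact (hYX₀ p' i).symm
      · exact hYd fun h => hne (by rw [h]))
    (by rintro (p | i); exacts [hX₀A p, (hYD i).trans sdiff_subset])
    (by
      refine measure_mono_null ?_ hY0
      rintro x ⟨hxA, hx⟩
      exact ⟨⟨hxA, fun h => hx ((mem_iUnion.1 h).elim fun p hp => mem_iUnion.2 ⟨Sum.inl p, hp⟩)⟩,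
        fun h => hx ((mem_iUnion.1 h).elim fun i hi => mem_iUnion.2 ⟨Sum.inr i, hi⟩)⟩)
    (by rintro (p | i); exacts [(hfm _).comp (measurable_iterZ P _), gfm i])
    (by
      rintro (p | i) x
      · obtain ⟨j, hj⟩ := hforb p.1.1 (iterZ P (-((p.1.2 : ℕ) : ℤ)) x)
        exact ⟨j + -((p.1.2 : ℕ) : ℤ), by rw [iterZ_add, ← hj]; rfl⟩
      · exact gforb i x)
    (by
      rintro (p | i)
      · have h1 := (measurePreserving_iterZ hP.toMeasurePreserving
          (-((p.1.2 : ℕ) : ℤ))).restrict_preimage (hW p.1.1)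
        rw [← hfmap p.1.1, ← h1.map_eq, Measure.map_map (hfm _) (measurable_iterZ P _)]
        rfl
      · exact gfmap i)
    (by
      rintro (p | i)
      · obtain ⟨G, hGW, hG, hG0, hGinj⟩ := hfinj p.1.1
        refine ⟨iterZ P (-((p.1.2 : ℕ) : ℤ)) ⁻¹' G, preimage_mono hGW, measurable_iterZ P _ hG,
          ?_, fun x hx y hy hxy => iterZ_injective P _ (hGinj hx hy hxy)⟩
        rw [← hG0, ← measure_preimage_iterZ hP.toMeasurePreserving (-((p.1.2 : ℕ) : ℤ))
          ((hW _).diff hG)]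
        rfl
      · exact gfinj i)
  have hgood : ∀ x ∈ A \ (A \ ⋃ p, X₀ p), ∃ p, x ∈ X₀ p := fun x hx =>
    mem_iUnion.1 (not_not.1 fun h => hx.2 ⟨hx.1, h⟩)
  refine ⟨k, hk1, A', e, π, harr, A \ ⋃ p, X₀ p, hA.diff hX₀U, ?_, ?_, ?_⟩
  · have hsub : A \ ⋃ p, X₀ p ⊆ {x | ∀ i < H, iterZ P (-(i : ℕ)) x ∉ C} ∪
        ⋃ j : Fin H, iterZ P (-((j : ℕ) : ℤ)) ⁻¹' (C \ ⋃ i, W i) := by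
      rintro x ⟨hxA, hx⟩
      by_cases hvis : ∃ i < H, iterZ P (-(i : ℕ)) x ∈ C
      · refine Or.inr ?_
        obtain ⟨j, hj, hxj⟩ := exists_mem_noReturn hvis
        refine mem_iUnion.2 ⟨⟨j, hj⟩, hxj.1, fun hxW => hx ?_⟩
        obtain ⟨i, hi⟩ := mem_iUnion.1 hxW
        refine mem_iUnion.2 ⟨⟨(i, ⟨j, hj⟩), (hLmem i ⟨j, hj⟩ _ hi).2 ⟨hxj, ?_⟩⟩, hi⟩
        rwa [iterZ_apply_neg]
      · left
        push Not at hvis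
        exact hvis
    calc ν (A \ ⋃ p, X₀ p) ≤ _ := measure_mono hsub
      _ ≤ _ := measure_union_le _ _
      _ ≤ δ / 2 + ∑ _j : Fin H, N * q := by
        refine add_le_add hH ((measure_iUnion_fintype_le _ _).trans
          (Finset.sum_le_sum fun j _ => ?_))
        rw [measure_preimage_iterZ hP.toMeasurePreserving _ (hC.diff (MeasurableSet.iUnion hW))]
        exact hrem
      _ = δ / 2 + H * (N * q) := by simp
      _ ≤ δ / 2 + δ / 2 := by gcongr
      _ = δ := ENNReal.add_halves δ
  · intro x hx m hmx hno
    obtain ⟨p, hp⟩ := hgood x hx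
    obtain ⟨p', hp'⟩ := hgood _ hmx
    have hc := (hX₀mem p x hp).1
    have hc' := (hX₀mem p' _ hp').1
    set c := iterZ P (-((p.1.2 : ℕ) : ℤ)) x with hcdef
    have hxc : x = iterZ P ((p.1.2 : ℕ) : ℤ) c := (iterZ_apply_neg P _ x).symm
    -- With no visit to `C` between `x` and its `m`-th iterate, both have the same base point `c`,
    -- hence the same column.
    have hlong : c ∈ noReturn P C (p.1.2 + m) := by
      refine ⟨hc.1, fun i hi0 hi => ?_⟩
      by_cases hij : i ≤ p.1.2
      · exact hc.2 i hi0 hij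
      · have h1 := hno (i - p.1.2) (by omega) (by omega)
        rw [hxc, ← iterZ_add] at h1
        have h2 : ((i - (p.1.2 : ℕ) : ℕ) : ℤ) + ((p.1.2 : ℕ) : ℤ) = i := by omega
        rwa [h2] at h1
    have huniq := noReturn_unique hlong hc' (by
      rw [iterZ_apply_neg, hxc, ← iterZ_add]
      congr 1
      push_cast; ring)
    have hi : p.1.1 = p'.1.1 := hWuniq _ _ _ hp (by
      have := huniq.2
      rw [hcdef] at this
      rw [this]; exact hp')
    have h1 := (hlabX (Sum.inl p) x hp).2
    have h2 := (hlabX (Sum.inl p') _ hp').2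
    rw [h1, h2]
    change hf p'.1.1 (iterZ P (-((p'.1.2 : ℕ) : ℤ)) (iterZ P m x)) = hf p.1.1 c
    rw [← huniq.2, hi]
  · intro x hx y hy hexy
    obtain ⟨p, hp⟩ := hgood x hx
    obtain ⟨p', hp'⟩ := hgood y hy
    have h1 := (hlabX (Sum.inl p) x hp).1
    have h2 := (hlabX (Sum.inl p') y hp').1
    have hpp : p = p' := Sum.inl_injective (hlab (h1.symm.trans (hexy.trans h2)))
    subst hpp
    have h3 : ∀ z, z ∈ X₀ p → b z = (t p.1.1 p.1.2).2 := fun z hz => by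
      have hz' : iterZ P (-((p.1.2 : ℕ) : ℤ)) z ∈ W p.1.1 := hz
      rw [← hWt _ _ hz']
      simp only [τ, iterZ_apply_neg]
    rw [h3 x hp, h3 y hp']

end Towers

/-! ### Refining an array over the whole space -/

section Refinement

variable {Ω : Type*} [MeasurableSpace Ω] [StandardBorelSpace Ω] {P : Ω ≃ᵐ Ω} {ν : Measure Ω}

/-- A measurable map along the orbits moves most points by a bounded number of steps. -/
theorem exists_bounded_displacement [IsFiniteMeasure ν] {π : Ω → Ω} (hπ : Measurable π)
    (horb : ∀ x, ∃ j : ℤ, π x = iterZ P j x) {δ : ℝ≥0∞} (hδ : δ ≠ 0) :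
    ∃ (M : ℕ) (E : Set Ω), MeasurableSet E ∧ ν Eᶜ ≤ δ ∧
      ∀ x ∈ E, ∃ j : ℤ, |j| ≤ M ∧ π x = iterZ P j x := by
  let E : ℕ → Set Ω := fun M => ⋃ (j : ℤ) (_ : |j| ≤ M), {x | π x = iterZ P j x}
  have hE : ∀ M, MeasurableSet (E M) := fun M => MeasurableSet.iUnion fun j =>
    MeasurableSet.iUnion fun _ => measurableSet_eq_fun hπ (measurable_iterZ P j)
  have hEmem : ∀ M x, x ∈ E M ↔ ∃ j : ℤ, |j| ≤ M ∧ π x = iterZ P j x := fun M x => by simp [E]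
  have h := tendsto_measure_iInter_atTop (μ := ν) (fun M => (hE M).compl.nullMeasurableSet)
    (fun a b hab x hx hxa => hx (by
      obtain ⟨j, hj, hj'⟩ := (hEmem a x).1 hxa
      exact (hEmem b x).2 ⟨j, hj.trans (by exact_mod_cast hab), hj'⟩)) ⟨0, measure_ne_top _ _⟩
  have h0 : ⋂ M, (E M)ᶜ = ∅ := by
    rw [← compl_iUnion, compl_empty_iff, eq_univ_iff_forall]
    intro x
    obtain ⟨j, hj⟩ := horb x
    exact mem_iUnion.2 ⟨j.natAbs, (hEmem _ x).2 ⟨j, (Int.natCast_natAbs j).ge, hj⟩⟩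
  rw [h0, measure_empty] at h
  obtain ⟨M, hM⟩ := (h.eventually (Iio_mem_nhds (pos_iff_ne_zero.2 hδ))).exists
  exact ⟨M, E M, hE M, le_of_lt hM, fun x hx => (hEmem M x).1 hx⟩

/-- Every set of positive measure has a subset of positive measure which is rarely visited in
a given window of time. -/
theorem exists_rarely_visited [IsFiniteMeasure ν] [NullSingletonClass ν]
    (hP : MeasurePreserving P ν ν) {A : Set Ω} (hA : MeasurableSet A) (hA0 : ν A ≠ 0) (M : ℕ)
    {δ : ℝ≥0∞} (hδ : δ ≠ 0) :
    ∃ C ⊆ A, MeasurableSet C ∧ ν C ≠ 0 ∧ ∃ Z, MeasurableSet Z ∧ ν Z ≤ δ ∧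
      ∀ x ∉ Z, ∀ j : ℤ, |j| ≤ M → iterZ P j x ∉ C := by
  set n := (Finset.Icc (-(M : ℤ)) M).card with hn
  have hn0 : (n : ℝ≥0∞) ≠ 0 := by
    have : 0 < n := Finset.card_pos.2 ⟨0, by simp⟩
    exact_mod_cast this.ne'
  -- Here `n` is the number of times in the window; a set `C` of measure at most `δ / n` is met
  -- within the window only from a set of measure at most `δ`.
  have hc0 : min (ν A) (δ / n) ≠ 0 := by
    simp only [ne_eq, min_eq_iff, not_or, not_and]
    exact ⟨fun h => absurd h hA0, fun h => absurd h
      (ENNReal.div_pos hδ (ENNReal.natCast_ne_top n)).ne'⟩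
  obtain ⟨C, hCA, hC, hCν⟩ := exists_subset_measure_eq hA (min_le_left (ν A) (δ / n))
  refine ⟨C, hCA, hC, hCν ▸ hc0, ⋃ j ∈ Finset.Icc (-(M : ℤ)) M, iterZ P j ⁻¹' C,
    Finset.measurableSet_biUnion _ fun j _ => measurable_iterZ P j hC, ?_, ?_⟩
  · calc ν (⋃ j ∈ Finset.Icc (-(M : ℤ)) M, iterZ P j ⁻¹' C)
        ≤ ∑ j ∈ Finset.Icc (-(M : ℤ)) M, ν (iterZ P j ⁻¹' C) := measure_biUnion_finset_le _ _
      _ = n * ν C := by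
        rw [Finset.sum_congr rfl fun j _ => measure_preimage_iterZ hP j hC]
        simp [hn]
      _ ≤ n * (δ / n) := by rw [hCν]; gcongr; exact min_le_right _ _
      _ = δ := ENNReal.mul_div_cancel hn0 (ENNReal.natCast_ne_top n)
  · intro x hx j hj hxj
    refine hx (mem_iUnion₂.2 ⟨j, ?_, hxj⟩)
    rw [Finset.mem_Icc]
    exact abs_le.1 hj

/-- Relative to an array on the whole space, every finite colouring is determined by the label
and a finite colouring of the projection. -/
theorem IsArray.exists_colouring_of_base {A A' : Set Ω} {k : ℕ} {e : Ω → ℕ} {π : Ω → Ω}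
    (h : IsArray P ν A A' k e π) {T : Type*} [Fintype T] [MeasurableSpace T]
    [MeasurableSingletonClass T] {b : Ω → T} (hb : Measurable b) :
    ∃ b' : Ω → Fin (2 ^ k) → T → Bool, Measurable b' ∧ ∃ G ⊆ A, MeasurableSet G ∧ ν (A \ G) = 0 ∧
      ∀ x ∈ G, ∀ y ∈ G, e x = e y → b' (π x) = b' (π y) → b x = b y := by
  classical
  obtain ⟨G, hGA, hG, hG0, hinj⟩ := h.inj
  -- The base points lying under a point of label `s` and colour `t`. The projection is injective on
  -- each label class of `G`, so these images are measurable, and knowing the label and all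
  -- memberships fixes the colour.
  let B : Fin (2 ^ k) → T → Set Ω := fun s t => π '' (G ∩ e ⁻¹' {(s : ℕ)} ∩ b ⁻¹' {t})
  have hB : ∀ s t, MeasurableSet (B s t) := fun s t => by
    refine MeasurableSet.image_of_measurable_injOn
      ((hG.inter (h.measurable_label (measurableSet_singleton _))).inter
        (hb (measurableSet_singleton _))) h.measurable_proj ?_
    rintro x ⟨⟨hx, hxs⟩, -⟩ y ⟨⟨hy, hys⟩, -⟩ hxy
    exact hinj x hx y hy (hxs.trans hys.symm) hxy
  refine ⟨fun x s t => decide (x ∈ B s t), ?_, G, hGA, hG, hG0, ?_⟩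
  · refine measurable_pi_lambda _ fun s => measurable_pi_lambda _ fun t => measurable_to_bool ?_
    have : (fun x => decide (x ∈ B s t)) ⁻¹' {true} = B s t := by ext x; simp
    rw [this]; exact hB s t
  · intro x hx y hy hexy hbxy
    have h1 : decide (π x ∈ B ⟨e x, h.label_lt x⟩ (b x)) = decide (π y ∈ B ⟨e x, h.label_lt x⟩ (b x)) :=
      congrFun (congrFun hbxy _) _
    have h2 : π x ∈ B ⟨e x, h.label_lt x⟩ (b x) := ⟨x, ⟨⟨hx, rfl⟩, rfl⟩, rfl⟩
    rw [decide_eq_decide] at h1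
    obtain ⟨z, ⟨⟨hz, hze⟩, hzb⟩, hzy⟩ := h1.1 h2
    have : z = y := hinj z hz y hy ((show e z = e x from hze).trans hexy) hzy
    rw [← this]
    exact (show b z = b x from hzb).symm

/-- An array on the whole space has a refinement in which `x` and `P x` have the same projection
for most `x`, and whose label determines a given colouring off a small set. -/
theorem IsArray.exists_refinement [IsFiniteMeasure ν] [NullSingletonClass ν] (hν : ν univ ≠ 0)
    (hP : Ergodic P ν) {A : Set Ω} {k : ℕ} {e : Ω → ℕ} {π : Ω → Ω}
    (h : IsArray P ν univ A k e π) {T : Type*} [Fintype T] [MeasurableSpace T]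
    [MeasurableSingletonClass T] {b : Ω → T} (hb : Measurable b) {δ : ℝ≥0∞} (hδ : δ ≠ 0) :
    ∃ k' ≥ 1, ∃ A' e' π', IsArray P ν A A' k' e' π' ∧ ∃ D, ν D ≤ δ ∧
      (∀ x ∉ D, π' (π (P x)) = π' (π x)) ∧
      (∀ x ∉ D, ∀ y ∉ D, e x = e y → e' (π x) = e' (π y) → b x = b y) := by
  classical
  have hA0 : ν A ≠ 0 := fun h0 => hν (by rw [h.measure_eq, h0, mul_zero])
  -- Five errors: large displacement at `x` and at `P x`, a visit to `C` near `x`, and a bad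
  -- projection of `x` or of `P x`.
  set η := δ / 5 with hη
  have hη0 : η ≠ 0 := (ENNReal.div_pos hδ (by simp)).ne'
  have h5 : η + η + η + η + η = δ := by
    have : η + η + η + η + η = 5 * η := by ring
    rw [this, hη]; exact ENNReal.mul_div_cancel (by simp) (by simp)
  have h2k : (2 : ℝ≥0∞) ^ k ≠ 0 := by positivity
  have h2k' : (2 : ℝ≥0∞) ^ k ≠ ∞ := ENNReal.pow_ne_top (by simp)
  obtain ⟨M, E, hE, hEν, hEM⟩ := exists_bounded_displacement (ν := ν) h.measurable_proj h.orbit hη0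
  -- The window is `M + 1` because `π (P x)` is displaced by at most `M` from `P x`, hence by at
  -- most `M + 1` from `x`.
  obtain ⟨C, hCA, hC, hC0, Z, hZ, hZν, hZC⟩ := exists_rarely_visited hP.toMeasurePreserving
    h.measurableSet_base hA0 (M + 1) hη0
  obtain ⟨b', hb', G, -, hG, hG0, hbG⟩ := h.exists_colouring_of_base hb
  obtain ⟨k', hk', A', e', π', h', D, hD, hDν, hDπ, hDb⟩ := exists_array_of_tower hP
    h.measurableSet_base hC hCA hC0 hb' (δ := η / 2 ^ k) (ENNReal.div_pos hη0 h2k').ne'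
  have hπD : ν (π ⁻¹' D) ≤ η := by
    have := h.measure_preimage hD
    rw [univ_inter] at this
    rw [this]
    calc 2 ^ k * ν (A ∩ D) ≤ 2 ^ k * (η / 2 ^ k) := by
          gcongr; exact (measure_mono inter_subset_right).trans hDν
      _ = η := ENNReal.mul_div_cancel h2k h2k'
  have hPm : ∀ s, MeasurableSet s → ν (P ⁻¹' s) = ν s := fun s hs =>
    hP.toMeasurePreserving.measure_preimage hs.nullMeasurableSet
  have hnull : ν ({x | π x ∉ A} ∪ P ⁻¹' {x | π x ∉ A} ∪ Gᶜ) = 0 := by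
    have h1 : ν {x | π x ∉ A} = 0 := by
      rw [measure_eq_zero_iff_ae_notMem]
      filter_upwards [h.ae_proj_mem] with x hx hcon
      exact hcon (hx (mem_univ x))
    refine measure_union_null (measure_union_null h1 ?_) (by rwa [compl_eq_univ_sdiff])
    exact (hPm _ (h.measurable_proj h.measurableSet_base.compl)).trans h1
  refine ⟨k', hk', A', e', π', h', (Eᶜ ∪ P ⁻¹' Eᶜ ∪ Z ∪ π ⁻¹' D ∪ P ⁻¹' (π ⁻¹' D)) ∪
    ({x | π x ∉ A} ∪ P ⁻¹' {x | π x ∉ A} ∪ Gᶜ), ?_, ?_, ?_⟩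
  · refine (measure_union_le _ _).trans ?_
    rw [hnull, add_zero, ← h5]
    refine (measure_union_le _ _).trans (add_le_add ((measure_union_le _ _).trans (add_le_add
      ((measure_union_le _ _).trans (add_le_add ((measure_union_le _ _).trans
        (add_le_add hEν ?_)) hZν)) hπD)) ?_)
    · rw [hPm _ hE.compl]; exact hEν
    · rw [hPm _ (h.measurable_proj hD)]; exact hπD
  · intro x hx
    simp only [mem_union, mem_compl_iff, mem_preimage, Set.mem_ofPred_eq, not_or, not_not] at hx
    obtain ⟨⟨⟨⟨⟨hxE, hPxE⟩, hxZ⟩, hxD⟩, hPxD⟩, ⟨hxA, hPxA⟩, -⟩ := hx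
    obtain ⟨i, hi, hix⟩ := hEM x hxE
    obtain ⟨i', hi', hix'⟩ := hEM (P x) hPxE
    rw [← iterZ_one P x, ← iterZ_add, iterZ_one] at hix'
    rw [abs_le] at hi hi'
    -- Both projections lie on the orbit of `x` inside the window. From the earlier to the later one
    -- there is no visit to `C`, so the tower array projects them to the same point.
    rcases le_total i (i' + 1) with hle | hle
    · obtain ⟨m, hm⟩ := Int.eq_ofNat_of_zero_le (sub_nonneg.2 hle)
      have hmx : iterZ P m (π x) = π (P x) := by
        rw [hix, ← iterZ_add, ← hm, hix']; congr 1; ring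
      rw [← hmx]
      refine hDπ _ ⟨hxA, hxD⟩ m (by rw [hmx]; exact ⟨hPxA, hPxD⟩) fun l hl hlm => ?_
      rw [hix, ← iterZ_add]
      exact hZC x hxZ _ (abs_le.2 ⟨by push_cast; omega, by push_cast; omega⟩)
    · obtain ⟨m, hm⟩ := Int.eq_ofNat_of_zero_le (sub_nonneg.2 hle)
      have hmx : iterZ P m (π (P x)) = π x := by
        rw [hix', ← iterZ_add, ← hm, hix]; congr 1; ring
      rw [← hmx]
      refine (hDπ _ ⟨hPxA, hPxD⟩ m (by rw [hmx]; exact ⟨hxA, hxD⟩) fun l hl hlm => ?_).symm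
      rw [hix', ← iterZ_add]
      exact hZC x hxZ _ (abs_le.2 ⟨by push_cast; omega, by push_cast; omega⟩)
  · intro x hx y hy hexy hexy'
    simp only [mem_union, mem_compl_iff, mem_preimage, Set.mem_ofPred_eq, not_or, not_not] at hx hy
    exact hbG x hx.2.2 y hy.2.2 hexy
      (hDb _ ⟨hx.2.1.1, hx.1.1.2⟩ _ ⟨hy.2.1.1, hy.1.1.2⟩ hexy')

end Refinement

/-! ### Generating digits with tails constant along orbits -/

section Digits

variable {Ω : Type*} [MeasurableSpace Ω]

/-- A sequence of binary digits is uniformly distributed if any `n` first digits take each value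
with the same probability. -/
def UniformDigits (ν : Measure Ω) (d : Ω → ℕ → Bool) : Prop :=
  ∀ (n : ℕ) (s : ℕ → Bool), 2 ^ n * ν {x | ∀ i < n, d x i = s i} = ν univ

theorem measurableSet_digits {d : Ω → ℕ → Bool} (hd : Measurable d) (n : ℕ) (s : ℕ → Bool) :
    MeasurableSet {x | ∀ i < n, d x i = s i} := by
  have : {x | ∀ i < n, d x i = s i} = ⋂ (i : ℕ) (_ : i < n), (fun x => d x i) ⁻¹' {s i} := by
    ext x; simp
  rw [this]
  exact MeasurableSet.iInter fun i => MeasurableSet.iInter fun _ =>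
    ((measurable_pi_apply i).comp hd) (measurableSet_singleton _)

/-- It suffices to check uniform distribution for arbitrarily large numbers of digits. -/
theorem UniformDigits.of_frequently {ν : Measure Ω} {d : Ω → ℕ → Bool} (hd : Measurable d)
    (h : ∀ n, ∃ m ≥ n, ∀ s : ℕ → Bool, 2 ^ m * ν {x | ∀ i < m, d x i = s i} = ν univ) :
    UniformDigits ν d := by
  intro n
  obtain ⟨m, hnm, hm⟩ := h n
  induction m, hnm using Nat.le_induction with
  | base => exact hm
  | succ m hnm ih =>
    refine ih fun s => ?_
    -- A cylinder of length `m` splits into two of length `m + 1`, so uniformity descends from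
    -- longer to shorter strings.
    have hset : {x | ∀ i < m, d x i = s i} =
        {x | ∀ i < m + 1, d x i = Function.update s m true i} ∪
          {x | ∀ i < m + 1, d x i = Function.update s m false i} := by
      ext x
      simp only [mem_union, Set.mem_ofPred_eq, Nat.lt_succ_iff_lt_or_eq,
        or_imp, forall_and, forall_eq, Function.update_self]
      have hne : ∀ c, (∀ i < m, d x i = Function.update s m c i) ↔ ∀ i < m, d x i = s i := fun c =>
        forall₂_congr fun i hi => by rw [Function.update_of_ne hi.ne]
      rw [hne, hne, ← and_or_left]
      cases d x m <;> simp
    have hdisj : Disjoint {x | ∀ i < m + 1, d x i = Function.update s m true i}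
        {x | ∀ i < m + 1, d x i = Function.update s m false i} := by
      refine disjoint_left.2 fun x hx hx' => ?_
      have h1 := hx m (Nat.lt_succ_self m)
      have h2 := hx' m (Nat.lt_succ_self m)
      rw [Function.update_self] at h1 h2
      rw [h1] at h2
      exact absurd h2 (by simp)
    have h1 := hm (Function.update s m true)
    have h2 := hm (Function.update s m false)
    rw [hset, measure_union hdisj (measurableSet_digits hd _ _), mul_add]
    have h2' : ∀ a : ℝ≥0∞, 2 ^ (m + 1) * a = ν univ → 2 ^ m * a = ν univ / 2 := fun a ha => by
      rw [← ha, pow_succ', mul_assoc, mul_comm 2, ENNReal.mul_div_cancel_right (by simp) (by simp)]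
    rw [h2' _ h1, h2' _ h2, ENNReal.add_halves]

variable [StandardBorelSpace Ω] {P : Ω ≃ᵐ Ω} {ν : Measure Ω}

/-- The sequence of arrays: each refines the previous one, has the same projection at `x` and
`P x` off a small set, and its labels determine more and more of the measurable structure. -/
theorem exists_array_sequence [IsFiniteMeasure ν] [NullSingletonClass ν] (hν : ν univ ≠ 0)
    (hP : Ergodic P ν) :
    ∃ (A : ℕ → Set Ω) (K : ℕ → ℕ) (e : ℕ → Ω → ℕ) (π : ℕ → Ω → Ω),
      (∀ n, IsArray P ν univ (A n) (K n) (e n) (π n)) ∧ (∀ n, K n < K (n + 1)) ∧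
      (∃ (e' : ℕ → Ω → ℕ) (π' : ℕ → Ω → Ω), ∀ n x,
        e (n + 1) x = e n x + 2 ^ K n * e' n (π n x) ∧ π (n + 1) x = π' n (π n x)) ∧
      ∃ D : ℕ → Set Ω, (∀ n, ν (D n) ≤ (1 / 2) ^ n) ∧
        (∀ n, ∀ x ∉ D n, π (n + 1) (P x) = π (n + 1) x) ∧
        (∀ n, ∀ x ∉ D n, ∀ y ∉ D n, e (n + 1) x = e (n + 1) y →
          ∀ i < n, MeasurableSpace.mapNatBool Ω x i = MeasurableSpace.mapNatBool Ω y i) := by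
  classical
  let St := {p : Set Ω × ℕ × (Ω → ℕ) × (Ω → Ω) // IsArray P ν univ p.1 p.2.1 p.2.2.1 p.2.2.2}
  have hstep : ∀ (n : ℕ) (S : St), ∃ (S' : St) (e' : Ω → ℕ) (π' : Ω → Ω) (D : Set Ω),
      S.1.2.1 < S'.1.2.1 ∧
      (∀ x, S'.1.2.2.1 x = S.1.2.2.1 x + 2 ^ S.1.2.1 * e' (S.1.2.2.2 x) ∧
        S'.1.2.2.2 x = π' (S.1.2.2.2 x)) ∧ ν D ≤ (1 / 2) ^ n ∧
      (∀ x ∉ D, S'.1.2.2.2 (P x) = S'.1.2.2.2 x) ∧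
      (∀ x ∉ D, ∀ y ∉ D, S'.1.2.2.1 x = S'.1.2.2.1 y →
        ∀ i < n, MeasurableSpace.mapNatBool Ω x i = MeasurableSpace.mapNatBool Ω y i) := by
    rintro n ⟨⟨A, K, e, π⟩, h⟩
    -- Stage `n` uses as colouring the first `n` coordinates of a code that separates points.
    have hb : Measurable fun x (i : Fin n) => MeasurableSpace.mapNatBool Ω x i :=
      measurable_pi_lambda _ fun i =>
        (measurable_pi_apply _).comp (MeasurableSpace.measurable_mapNatBool Ω)
    obtain ⟨k', hk', A', e', π', h', D, hD, hDπ, hDb⟩ := h.exists_refinement hν hP hb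
      (δ := (1 / 2) ^ n) (ENNReal.pow_pos (by simp) n).ne'
    refine ⟨⟨⟨A', K + k', fun x => e x + 2 ^ K * e' (π x), π' ∘ π⟩, h.comp h'⟩, e', π', D,
      Nat.lt_add_of_pos_right hk', fun x => ⟨rfl, rfl⟩, hD, hDπ, fun x hx y hy hxy i hi => ?_⟩
    have hk : 0 < 2 ^ K := by positivity
    have hmod := congrArg (· % 2 ^ K) hxy
    have hdiv := congrArg (· / 2 ^ K) hxy
    simp only [Nat.add_mul_mod_self_left, Nat.mod_eq_of_lt (h.label_lt _)] at hmod
    simp only [Nat.add_mul_div_left _ _ hk, Nat.div_eq_of_lt (h.label_lt _), zero_add] at hdiv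
    exact congrFun (hDb x hx y hy hmod hdiv) ⟨i, hi⟩
  choose nxt e' π' D h1 h2 h3 h4 h5 using hstep
  let S : ℕ → St := fun n =>
    Nat.rec ⟨⟨univ, 0, fun _ => 0, id⟩, IsArray.refl P ν MeasurableSet.univ⟩ nxt n
  exact ⟨fun n => (S n).1.1, fun n => (S n).1.2.1, fun n => (S n).1.2.2.1, fun n => (S n).1.2.2.2,
    fun n => (S n).2, fun n => h1 n (S n), ⟨fun n => e' n (S n), fun n => π' n (S n),
    fun n x => h2 n (S n) x⟩, fun n => D n (S n), fun n => h3 n (S n), fun n => h4 n (S n),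
    fun n => h5 n (S n)⟩

/-- An ergodic transformation of an atomless space admits a generating sequence of independent
fair binary digits, each orbit having a well-defined tail. -/
theorem exists_digits [IsFiniteMeasure ν] [NullSingletonClass ν] (hν : ν univ ≠ 0)
    (hP : Ergodic P ν) :
    ∃ d : Ω → ℕ → Bool, Measurable d ∧ UniformDigits ν d ∧
      (∀ᵐ x ∂ν, ∃ N, ∀ i ≥ N, d (P x) i = d x i) ∧
      ∃ G : Set Ω, MeasurableSet G ∧ ν Gᶜ = 0 ∧ InjOn d G := by
  obtain ⟨A, K, e, π, h, hK, ⟨e', π', hrec⟩, D, hD, hDπ, hDb⟩ := exists_array_sequence hν hP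
  have hKmono : StrictMono K := strictMono_nat_of_lt_succ hK
  have hKle : ∀ n, n ≤ K n := hKmono.id_le
  have hmod : ∀ m n, m ≤ n → ∀ x, e n x % 2 ^ K m = e m x := by
    intro m n hmn x
    induction n, hmn using Nat.le_induction with
    | base => exact Nat.mod_eq_of_lt ((h m).label_lt x)
    | succ n hmn ih =>
      have hdvd : 2 ^ K m ∣ 2 ^ K n * e' n (π n x) :=
        Dvd.dvd.mul_right (pow_dvd_pow 2 (hKmono.monotone hmn)) _
      rw [(hrec n x).1, Nat.add_mod, Nat.mod_eq_zero_of_dvd hdvd, add_zero, Nat.mod_mod, ih]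
  -- Since `i + 1 ≤ K (i + 1)`, bit `i` is already settled at stage `i + 1` and agrees with that bit
  -- at every later stage.
  let d : Ω → ℕ → Bool := fun x i => (e (i + 1) x).testBit i
  have hbit : ∀ m n, m ≤ n → ∀ i < K m, ∀ x, (e n x).testBit i = (e m x).testBit i := by
    intro m n hmn i hi x
    rw [← hmod m n hmn x, Nat.testBit_mod_two_pow]
    simp [hi]
  have hd : ∀ n, ∀ i < K n, ∀ x, d x i = (e n x).testBit i := by
    intro n i hi x
    rcases le_total n (i + 1) with hle | hle
    · exact hbit n (i + 1) hle i hi x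
    · exact (hbit (i + 1) n hle i (hKle (i + 1)) x).symm
  have hdm : Measurable d := measurable_pi_lambda _ fun i =>
    (measurable_of_countable fun a : ℕ => a.testBit i).comp (h (i + 1)).measurable_label
  have hlab : ∀ n x y, (∀ i < K n, d x i = d y i) → e n x = e n y := by
    intro n x y hxy
    refine Nat.eq_of_testBit_eq fun i => ?_
    by_cases hi : i < K n
    · rw [← hd n i hi, ← hd n i hi, hxy i hi]
    · rw [Nat.testBit_lt_two_pow, Nat.testBit_lt_two_pow] <;>
        exact ((h n).label_lt _).trans_le (Nat.pow_le_pow_right (by norm_num) (not_lt.1 hi))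
  have hsum : ∑' n, ν (D n) ≠ ∞ := by
    refine ne_top_of_le_ne_top ?_ (ENNReal.tsum_le_tsum hD)
    rw [ENNReal.tsum_geometric]
    simp
  refine ⟨d, hdm, UniformDigits.of_frequently hdm fun n => ⟨K n, hKle n, fun s => ?_⟩, ?_, ?_⟩
  · have hs : Nat.ofBits (fun i : Fin (K n) => s i) < 2 ^ K n := Nat.ofBits_lt_two_pow _
    have hset : {x | ∀ i < K n, d x i = s i} =
        univ ∩ e n ⁻¹' {Nat.ofBits (fun i : Fin (K n) => s i)} := by
      ext x
      simp only [univ_inter, mem_preimage, mem_singleton_iff, Set.mem_ofPred_eq]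
      constructor
      · intro hx
        refine Nat.eq_of_testBit_eq fun i => ?_
        by_cases hi : i < K n
        · rw [← hd n i hi, hx i hi, Nat.testBit_ofBits_lt _ _ hi]
        · rw [Nat.testBit_lt_two_pow, Nat.testBit_lt_two_pow]
          · exact hs.trans_le (Nat.pow_le_pow_right (by norm_num) (not_lt.1 hi))
          · exact ((h n).label_lt _).trans_le (Nat.pow_le_pow_right (by norm_num) (not_lt.1 hi))
      · intro hx i hi
        rw [hd n i hi, hx, Nat.testBit_ofBits_lt _ _ hi]
    rw [hset, (h n).measure_label hs, (h n).measure_eq]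
  · filter_upwards [ae_eventually_notMem hsum] with x hx
    obtain ⟨n, hn⟩ := hx.exists
    have heq := hDπ n x hn
    -- One good stage suffices: later projections, and the bits from `K (n + 1)` on, are functions
    -- of the projection at stage `n + 1`, which is the same at `x` and `P x`.
    have key : ∀ m ≥ n + 1, π m (P x) = π m x ∧
        e m (P x) / 2 ^ K (n + 1) = e m x / 2 ^ K (n + 1) := by
      intro m hm
      induction m, hm using Nat.le_induction with
      | base =>
        refine ⟨heq, ?_⟩
        rw [Nat.div_eq_of_lt ((h _).label_lt _), Nat.div_eq_of_lt ((h _).label_lt _)]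
      | succ m hm ih =>
        refine ⟨by rw [(hrec m _).2, (hrec m x).2, ih.1], ?_⟩
        have hp : 2 ^ K m = 2 ^ K (n + 1) * 2 ^ (K m - K (n + 1)) := by
          rw [← pow_add]; congr 1
          have := hKmono.monotone hm
          omega
        rw [(hrec m _).1, (hrec m x).1, ih.1, hp, mul_assoc,
          Nat.add_mul_div_left _ _ (by positivity), Nat.add_mul_div_left _ _ (by positivity), ih.2]
    refine ⟨K (n + 1), fun i hi => ?_⟩
    have hm : n + 1 ≤ i + 1 := ((hKle (n + 1)).trans hi).trans (Nat.le_succ i)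
    have := congrArg (fun a => a.testBit (i - K (n + 1))) (key (i + 1) hm).2
    simpa only [Nat.testBit_div_two_pow, Nat.sub_add_cancel hi] using this
  · have hae := ae_eventually_notMem hsum
    obtain ⟨G, hGsub, hG, hG0⟩ : ∃ G ⊆ {x | ∀ᶠ n in atTop, x ∉ D n}, MeasurableSet G ∧ ν Gᶜ = 0 := by
      obtain ⟨U, hU, hUm, hU0⟩ := exists_measurable_superset_of_null hae
      exact ⟨Uᶜ, fun x hx => not_not.1 fun hc => hx (hU hc), hUm.compl, by rwa [compl_compl]⟩
    refine ⟨G, hG, hG0, fun x hx y hy hxy => MeasurableSpace.injective_mapNatBool Ω (funext fun i => ?_)⟩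
    -- A stage beyond `i` at which both points are good: equal digits give equal labels, hence equal
    -- `i`-th coordinates of the code.
    obtain ⟨n, ⟨hn1, hn2⟩, hin⟩ :=
      (((hGsub hx).and (hGsub hy)).and (eventually_gt_atTop i)).exists
    exact hDb n x hn1 y hn2 (hlab _ x y fun j _ => congrFun hxy j) i hin

end Digits

/-! ### Binary expansions and Haar measure on the dyadic integers -/

section DyadicIntegers

/-- The dyadic integer with given binary digits. -/
noncomputable def dyadicOfDigits (s : ℕ → Bool) : ℤ_[2] := ∑' i, if s i then (2 : ℤ_[2]) ^ i else 0

theorem summable_dyadicOfDigits (s : ℕ → Bool) :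
    Summable fun i => if s i then (2 : ℤ_[2]) ^ i else 0 := by
  refine Summable.of_norm_bounded (g := fun i : ℕ => (1 / 2 : ℝ) ^ i)
    (summable_geometric_of_lt_one (by norm_num) (by norm_num)) fun i => ?_
  have h2 : ‖(2 : ℤ_[2])‖ = 1 / 2 := by
    have := PadicInt.norm_p (p := 2)
    simpa using this
  split_ifs
  · rw [norm_pow, h2]
  · rw [norm_zero]; positivity

theorem dyadicOfDigits_succ (s : ℕ → Bool) :
    dyadicOfDigits s = ((s 0).toNat : ℤ_[2]) + 2 * dyadicOfDigits fun i => s (i + 1) := by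
  rw [dyadicOfDigits, (summable_dyadicOfDigits s).tsum_eq_zero_add, dyadicOfDigits,
    ← (summable_dyadicOfDigits _).tsum_mul_left]
  congr 1
  · cases s 0 <;> simp
  · refine tsum_congr fun i => ?_
    split_ifs
    · rw [pow_succ']
    · rw [mul_zero]

theorem dyadicOfDigits_eq_ofBits_add (n : ℕ) : ∀ s : ℕ → Bool,
    dyadicOfDigits s = ((Nat.ofBits fun i : Fin n => s i : ℕ) : ℤ_[2]) +
      2 ^ n * dyadicOfDigits fun i => s (i + n) := by
  induction n with
  | zero => intro s; simp
  | succ n ih =>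
    intro s
    rw [dyadicOfDigits_succ, ih, Nat.ofBits_succ]
    have : (fun i => s (i + n + 1)) = fun i => s (i + (n + 1)) := rfl
    rw [this]
    have h2 : ((fun i : Fin (n + 1) => s i) ∘ Fin.succ) = fun i : Fin n => s (i + 1) := by
      ext i; simp
    rw [h2]
    push_cast
    simp only [Fin.val_zero]
    ring

/-- Past `N` the two expansions contribute the same multiple of `2 ^ N`; only two natural numbers
below `2 ^ N` differ. The converse fails: carrying makes `-1` and `0` differ by an integer with
tails all one and all zero. -/
theorem exists_intCast_eq_of_tail_eq {s s' : ℕ → Bool} {N : ℕ} (h : ∀ i ≥ N, s' i = s i) :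
    ∃ k : ℤ, dyadicOfDigits s' = dyadicOfDigits s + k := by
  rw [dyadicOfDigits_eq_ofBits_add N s, dyadicOfDigits_eq_ofBits_add N s']
  have : (fun i => s' (i + N)) = fun i => s (i + N) := funext fun i => h _ (Nat.le_add_left _ _)
  rw [this]
  exact ⟨((Nat.ofBits fun i : Fin N => s' i : ℕ) : ℤ) - (Nat.ofBits fun i : Fin N => s i : ℕ),
    by push_cast; ring⟩

theorem toZModPow_dyadicOfDigits (n : ℕ) (s : ℕ → Bool) :
    PadicInt.toZModPow n (dyadicOfDigits s) = ((Nat.ofBits fun i : Fin n => s i : ℕ) : ZMod (2 ^ n)) := by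
  rw [dyadicOfDigits_eq_ofBits_add n s, map_add, map_mul, map_natCast]
  have : PadicInt.toZModPow n ((2 : ℤ_[2]) ^ n) = 0 := by
    have h : ((2 : ℤ_[2]) ^ n) = ((2 ^ n : ℕ) : ℤ_[2]) := by push_cast; rfl
    rw [h, map_natCast, ZMod.natCast_self]
  rw [this, zero_mul, add_zero]

theorem toZModPow_dyadicOfDigits_eq_iff (n : ℕ) (s : ℕ → Bool) (c : ZMod (2 ^ n)) :
    PadicInt.toZModPow n (dyadicOfDigits s) = c ↔ ∀ i < n, s i = c.val.testBit i := by
  have : NeZero (2 ^ n) := ⟨by positivity⟩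
  have hlt : (Nat.ofBits fun i : Fin n => s i) < 2 ^ n := Nat.ofBits_lt_two_pow _
  rw [toZModPow_dyadicOfDigits, ← (ZMod.val_injective (2 ^ n)).eq_iff, ZMod.val_natCast,
    Nat.mod_eq_of_lt hlt]
  constructor
  · intro h i hi
    rw [← h, Nat.testBit_ofBits_lt _ _ hi]
  · intro h
    refine Nat.eq_of_testBit_eq fun i => ?_
    by_cases hi : i < n
    · rw [Nat.testBit_ofBits_lt _ _ hi, h i hi]
    · rw [Nat.testBit_ofBits_ge _ _ (not_lt.1 hi), Nat.testBit_lt_two_pow]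
      exact (ZMod.val_lt c).trans_le (Nat.pow_le_pow_right (by norm_num) (not_lt.1 hi))

theorem dyadicOfDigits_injective : Function.Injective dyadicOfDigits := by
  intro s s' h
  funext i
  have h1 := (toZModPow_dyadicOfDigits_eq_iff (i + 1) s' _).1 rfl i (Nat.lt_succ_self i)
  have h2 := (toZModPow_dyadicOfDigits_eq_iff (i + 1) s _).1 rfl i (Nat.lt_succ_self i)
  rw [h1, h2, h]

/-- The residue classes modulo powers of two. -/
def residueClasses : Set (Set ℤ_[2]) :=
  {U | ∃ (n : ℕ) (c : ZMod (2 ^ n)), U = PadicInt.toZModPow n ⁻¹' {c}}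

theorem mem_residueClass_iff (n : ℕ) (x y : ℤ_[2]) :
    PadicInt.toZModPow n y = PadicInt.toZModPow n x ↔ dist y x ≤ (2 : ℝ) ^ (-n : ℤ) := by
  rw [dist_eq_norm]
  have := PadicInt.norm_le_pow_iff_mem_span_pow (p := 2) (y - x) n
  rw [← PadicInt.ker_toZModPow, RingHom.mem_ker, map_sub, sub_eq_zero] at this
  exact_mod_cast this.symm

theorem isOpen_residueClass (n : ℕ) (c : ZMod (2 ^ n)) :
    IsOpen ((PadicInt.toZModPow n : ℤ_[2] →+* ZMod (2 ^ n)) ⁻¹' {c}) := by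
  rw [Metric.isOpen_iff]
  intro x hx
  refine ⟨(2 : ℝ) ^ (-n : ℤ), by positivity, fun y hy => ?_⟩
  rw [mem_preimage, mem_singleton_iff] at hx ⊢
  rw [← hx, mem_residueClass_iff]
  exact (Metric.mem_ball.1 hy).le

theorem isTopologicalBasis_residueClasses :
    TopologicalSpace.IsTopologicalBasis residueClasses := by
  refine TopologicalSpace.isTopologicalBasis_of_isOpen_of_nhds ?_ ?_
  · rintro _ ⟨n, c, rfl⟩
    exact isOpen_residueClass n c
  · intro x V hx hV
    obtain ⟨ε, hε, hball⟩ := Metric.isOpen_iff.1 hV x hx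
    obtain ⟨n, hn⟩ := PadicInt.exists_pow_neg_lt 2 hε
    refine ⟨_, ⟨n, PadicInt.toZModPow n x, rfl⟩, rfl, fun y hy => hball ?_⟩
    refine Metric.mem_ball.2 (((mem_residueClass_iff n x y).1 hy).trans_lt ?_)
    exact_mod_cast hn

theorem dyadicMeasurableSpace_eq_generateFrom :
    dyadicMeasurableSpace = MeasurableSpace.generateFrom residueClasses :=
  isTopologicalBasis_residueClasses.borel_eq_generateFrom

theorem isPiSystem_residueClasses : IsPiSystem residueClasses := by
  have key : ∀ (m n : ℕ) (c : ZMod (2 ^ m)) (c' : ZMod (2 ^ n)), m ≤ n →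
      ((PadicInt.toZModPow m ⁻¹' {c} : Set ℤ_[2]) ∩ PadicInt.toZModPow n ⁻¹' {c'}).Nonempty →
      (PadicInt.toZModPow m ⁻¹' {c} : Set ℤ_[2]) ∩ PadicInt.toZModPow n ⁻¹' {c'} =
        PadicInt.toZModPow n ⁻¹' {c'} := by
    rintro m n c c' hmn ⟨x, hx, hx'⟩
    refine inter_eq_right.2 fun y hy => ?_
    rw [mem_preimage, mem_singleton_iff] at hx hx' hy ⊢
    rw [← hx, ← PadicInt.cast_toZModPow m n hmn, ← PadicInt.cast_toZModPow m n hmn, hy, hx']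
  rintro _ ⟨m, c, rfl⟩ _ ⟨n, c', rfl⟩ hne
  rcases le_total m n with h | h
  · exact ⟨n, c', key m n c c' h hne⟩
  · rw [inter_comm] at hne ⊢
    exact ⟨m, c, key n m c' c h hne⟩

instance : IsProbabilityMeasure dyadicHaar :=
  ⟨Measure.addHaarMeasure_self (K₀ := (⊤ : TopologicalSpace.PositiveCompacts ℤ_[2]))⟩

instance : Measure.IsAddLeftInvariant dyadicHaar := by
  unfold dyadicHaar; infer_instance

/-- The `2 ^ n` classes are translates of one another and partition a space of mass one. -/
theorem dyadicHaar_residueClass (n : ℕ) (c : ZMod (2 ^ n)) :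
    2 ^ n * dyadicHaar (PadicInt.toZModPow n ⁻¹' {c}) = 1 := by
  have : NeZero (2 ^ n) := ⟨by positivity⟩
  have hmeas : ∀ c : ZMod (2 ^ n), MeasurableSet (PadicInt.toZModPow n ⁻¹' {c} : Set ℤ_[2]) :=
    fun c => (isOpen_residueClass n c).measurableSet
  have hc : ∀ c : ZMod (2 ^ n), dyadicHaar (PadicInt.toZModPow n ⁻¹' {c}) =
      dyadicHaar (PadicInt.toZModPow n ⁻¹' {0}) := by
    intro c
    rw [← measure_preimage_add dyadicHaar ((c.val : ℕ) : ℤ_[2]) (PadicInt.toZModPow n ⁻¹' {c})]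
    congr 1
    ext x
    simp
  have hU : (univ : Set ℤ_[2]) = ⋃ c : ZMod (2 ^ n), PadicInt.toZModPow n ⁻¹' {c} := by
    ext x; simp
  have h1 : dyadicHaar univ = 1 := measure_univ
  rw [hU, measure_iUnion (fun c c' h => disjoint_left.2 fun x hx hx' => h (hx.symm.trans hx'))
    hmeas, tsum_fintype, Finset.sum_congr rfl fun c' _ => (hc c').trans (hc c).symm] at h1
  rw [← h1]
  simp [ZMod.card]

/-- Residue classes form a generating π-system, and their preimages are the cylinders on which
`UniformDigits` prescribes the measure. -/
theorem UniformDigits.measurePreserving {Ω : Type*} [MeasurableSpace Ω] {ν : Measure Ω}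
    [IsFiniteMeasure ν] {d : Ω → ℕ → Bool} (hd : Measurable d) (h : UniformDigits ν d) :
    MeasurePreserving (fun x => dyadicOfDigits (d x)) ν (ν univ • dyadicHaar) := by
  have hpre : ∀ n (c : ZMod (2 ^ n)),
      (fun x => dyadicOfDigits (d x)) ⁻¹' (PadicInt.toZModPow n ⁻¹' {c}) =
        {x | ∀ i < n, d x i = c.val.testBit i} := fun n c => by
    ext x
    exact toZModPow_dyadicOfDigits_eq_iff n (d x) c
  have hm : Measurable fun x => dyadicOfDigits (d x) := by
    rw [dyadicMeasurableSpace_eq_generateFrom]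
    refine measurable_generateFrom ?_
    rintro _ ⟨n, c, rfl⟩
    rw [hpre]
    exact measurableSet_digits hd _ _
  refine ⟨hm, ?_⟩
  refine ext_of_generate_finite residueClasses dyadicMeasurableSpace_eq_generateFrom
    isPiSystem_residueClasses ?_ ?_
  · rintro _ ⟨n, c, rfl⟩
    rw [Measure.map_apply hm (isOpen_residueClass n c).measurableSet, hpre, Measure.smul_apply,
      smul_eq_mul]
    have h1 := h n fun i => c.val.testBit i
    have h2 := dyadicHaar_residueClass n c
    have h3 : (2 : ℝ≥0∞) ^ n ≠ 0 := by positivity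
    have h4 : (2 : ℝ≥0∞) ^ n ≠ ∞ := ENNReal.pow_ne_top (by simp)
    refine (ENNReal.mul_right_inj h3 h4).1 ?_
    rw [h1, mul_left_comm, h2, mul_one]
  · rw [Measure.map_apply hm MeasurableSet.univ]
    simp

end DyadicIntegers

/-! ### Recoding digits to split tail classes -/

section Twist

/-- The transformation of binary sequences adding the digit `i / 2` to the digit `i`, for even
`i > 0`. -/
def twist (s : ℕ → Bool) (i : ℕ) : Bool := if 0 < i ∧ 2 ∣ i then xor (s i) (s (i / 2)) else s i

/-- The inverse of `twist`. -/
def untwist (s : ℕ → Bool) (i : ℕ) : Bool :=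
  if h : 0 < i ∧ 2 ∣ i then xor (s i) (untwist s (i / 2)) else s i
  termination_by i
  decreasing_by exact Nat.div_lt_self h.1 (by norm_num)

theorem twist_untwist (s : ℕ → Bool) : twist (untwist s) = s := by
  funext i
  rw [twist]
  split_ifs with h
  · rw [untwist, dif_pos h, Bool.xor_assoc, Bool.xor_self, Bool.xor_false]
  · rw [untwist, dif_neg h]

/-- The recoding is triangular: digit `i` is altered only by digit `i / 2`, which is earlier.
Initial segments of equal length determine each other, and this gives both injectivity and
preservation of uniform digits. -/
theorem twist_eq_on_iff {s s' : ℕ → Bool} (n : ℕ) :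
    (∀ i < n, twist s i = twist s' i) ↔ ∀ i < n, s i = s' i := by
  constructor
  · intro h i
    induction i using Nat.strong_induction_on with
    | _ i ih =>
      intro hi
      have h1 := h i hi
      rw [twist, twist] at h1
      split_ifs at h1 with hc
      · have hlt : i / 2 < i := Nat.div_lt_self hc.1 (by norm_num)
        rwa [ih _ hlt (hlt.trans hi), Bool.xor_left_inj] at h1
      · exact h1
  · intro h i hi
    rw [twist, twist, h i hi, h (i / 2) ((Nat.div_le_self _ _).trans_lt hi)]

theorem twist_injective : Function.Injective twist := fun _ _ h =>
  funext fun i => (twist_eq_on_iff (i + 1)).1 (fun j _ => congrFun h j) i (Nat.lt_succ_self i)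

theorem twist_tail_eq {s s' : ℕ → Bool} {N : ℕ} (h : ∀ i ≥ N, s' i = s i) :
    ∀ i ≥ 2 * N, twist s' i = twist s i := fun i hi => by
  rw [twist, twist, h i (by omega), h (i / 2) (by omega)]

theorem measurable_twist : Measurable twist := by
  refine measurable_pi_lambda _ fun i => ?_
  by_cases hc : 0 < i ∧ 2 ∣ i
  · have : (fun s => twist s i) = (fun p : Bool × Bool => xor p.1 p.2) ∘ fun s => (s i, s (i / 2)) :=
      funext fun s => by rw [twist, if_pos hc]; rfl
    rw [this]
    exact (measurable_of_countable _).comp ((measurable_pi_apply i).prodMk (measurable_pi_apply _))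
  · have : (fun s => twist s i) = fun s => s i := funext fun s => by rw [twist, if_neg hc]
    rw [this]
    exact measurable_pi_apply i

theorem UniformDigits.comp_twist {Ω : Type*} [MeasurableSpace Ω] {ν : Measure Ω} {d : Ω → ℕ → Bool}
    (h : UniformDigits ν d) : UniformDigits ν fun x => twist (d x) := by
  intro n s
  rw [← h n (untwist s)]
  congr 2
  ext x
  have := twist_eq_on_iff (s := d x) (s' := untwist s) n
  rwa [twist_untwist] at this

/-- Changing the odd digit `2 * j + 1` of a sequence changes the untwisted sequence at the
indices `(2 * j + 1) * 2 ^ m`. -/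
theorem untwist_update_odd (s : ℕ → Bool) (j j' m : ℕ) :
    untwist (Function.update s (2 * j + 1) !(s (2 * j + 1))) ((2 * j' + 1) * 2 ^ m) =
      xor (untwist s ((2 * j' + 1) * 2 ^ m)) (decide (j' = j)) := by
  -- Halving leads from `(2 * j' + 1) * 2 ^ m` down to its odd part, and the untwisted digit is the
  -- sum modulo 2 of the digits met on the way. A flip at the odd end therefore propagates up the
  -- entire chain, and to no other chain.
  induction m with
  | zero =>
    have hn : ¬(0 < (2 * j' + 1) * 2 ^ 0 ∧ 2 ∣ (2 * j' + 1) * 2 ^ 0) := by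
      rw [pow_zero, mul_one]; omega
    rw [untwist, dif_neg hn, untwist, dif_neg hn, pow_zero, mul_one]
    by_cases hj : j' = j
    · subst hj; simp
    · rw [Function.update_of_ne (by omega)]; simp [hj]
  | succ m ih =>
    have hp : 0 < (2 * j' + 1) * 2 ^ (m + 1) ∧ 2 ∣ (2 * j' + 1) * 2 ^ (m + 1) :=
      ⟨by positivity, Dvd.dvd.mul_left (dvd_pow_self 2 (Nat.succ_ne_zero m)) _⟩
    have hdiv : (2 * j' + 1) * 2 ^ (m + 1) / 2 = (2 * j' + 1) * 2 ^ m := by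
      rw [pow_succ, ← mul_assoc, Nat.mul_div_cancel _ (by norm_num)]
    rw [untwist, dif_pos hp, hdiv, ih, Function.update_of_ne (by omega), ← Bool.xor_assoc]
    conv_rhs => rw [untwist, dif_pos hp, hdiv]

/-- The first flip alters the untwisted string along the whole chain over `2 * j + 1`, while the
second leaves that chain alone; the chain has members beyond every `N`. -/
theorem not_tail_eq_untwist_update {s : ℕ → Bool} {j j' : ℕ} (hj : j ≠ j') (N : ℕ) :
    ∃ i ≥ N, untwist (Function.update s (2 * j + 1) !(s (2 * j + 1))) i ≠
      untwist (Function.update s (2 * j' + 1) !(s (2 * j' + 1))) i := by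
  refine ⟨(2 * j + 1) * 2 ^ N, ?_, ?_⟩
  · exact (Nat.lt_two_pow_self).le.trans (Nat.le_mul_of_pos_left _ (by omega))
  · rw [untwist_update_odd, untwist_update_odd]
    simp [hj]

end Twist

/-! ### Orbits of the odometer and invariance along orbits -/

section Orbits

theorem odometer_zpow_apply (k : ℤ) (x : ℤ_[2]) :
    (odometer.toEquiv ^ k : Equiv.Perm ℤ_[2]) x = x + k := by
  change iterZ odometer k x = x + k
  have hone : ∀ y : ℤ_[2], odometer y = y + 1 := fun y => rfl
  have hsymm : ∀ y : ℤ_[2], odometer.symm y = y - 1 := fun y => by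
    refine odometer.injective ?_
    rw [odometer.apply_symm_apply, hone]; ring
  induction k using Int.induction_on generalizing x with
  | zero => simp [iterZ_zero]
  | succ n ih => rw [iterZ_add, iterZ_one, ih, hone]; push_cast; ring
  | pred n ih => rw [sub_eq_add_neg, iterZ_add, iterZ_neg_one, ih, hsymm]; push_cast; ring

theorem mem_fullOrbit_odometer {x y : ℤ_[2]} :
    y ∈ fullOrbit odometer x ↔ ∃ k : ℤ, y = x + k := by
  simp only [fullOrbit, Set.mem_ofPred_eq, odometer_zpow_apply, eq_comm]

theorem countable_fullOrbit {X : Type*} [MeasurableSpace X] (S : X ≃ᵐ X) (x : X) :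
    (fullOrbit S x).Countable :=
  (countable_range fun k : ℤ => (S.toEquiv ^ k : Equiv.Perm X) x).mono
    (by rintro _ ⟨k, hk⟩; exact ⟨k, hk⟩)

theorem mem_fullOrbit_self {X : Type*} [MeasurableSpace X] (S : X ≃ᵐ X) (x : X) :
    x ∈ fullOrbit S x := ⟨0, by simp⟩

/-- A property preserved by a transformation and its inverse holds along the whole orbit. -/
theorem forall_mem_fullOrbit {X : Type*} [MeasurableSpace X] {S : X ≃ᵐ X} {p : X → Prop}
    (h : ∀ y, p y → p (S y)) (h' : ∀ y, p y → p (S.symm y)) {x : X} (hx : p x) :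
    ∀ y ∈ fullOrbit S x, p y := by
  rintro _ ⟨k, rfl⟩
  change p (iterZ S k x)
  induction k using Int.induction_on generalizing x with
  | zero => rwa [iterZ_zero]
  | succ n ih => rw [iterZ_add, iterZ_one]; exact ih (h x hx)
  | pred n ih => rw [sub_eq_add_neg, iterZ_add, iterZ_neg_one]; exact ih (h' x hx)

end Orbits

/-! ### Transporting the transformation to the dyadic integers -/

section Realization

variable {Ω : Type*} [MeasurableSpace Ω] {P : Ω ≃ᵐ Ω}

/-- An almost sure property holds on an invariant measurable conull set. -/
theorem exists_invariant_conull {ν : Measure Ω} (hP : MeasurePreserving P ν ν) {p : Ω → Prop}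
    (hp : ∀ᵐ x ∂ν, p x) :
    ∃ X : Set Ω, MeasurableSet X ∧ ν Xᶜ = 0 ∧ (∀ x ∈ X, p x) ∧ (∀ x ∈ X, P x ∈ X) ∧
      ∀ x ∈ X, P.symm x ∈ X := by
  obtain ⟨U, hU, hUm, hU0⟩ := exists_measurable_superset_of_null hp
  refine ⟨⋂ k : ℤ, iterZ P k ⁻¹' Uᶜ, MeasurableSet.iInter fun k => measurable_iterZ P k hUm.compl,
    ?_, ?_, ?_, ?_⟩
  · rw [compl_iInter]
    refine measure_iUnion_null fun k => ?_
    rw [← preimage_compl, compl_compl, measure_preimage_iterZ hP k hUm, hU0]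
  · intro x hx
    have := mem_iInter.1 hx 0
    rw [mem_preimage, iterZ_zero] at this
    exact not_not.1 fun hc => this (hU hc)
  · intro x hx
    refine mem_iInter.2 fun k => ?_
    have := mem_iInter.1 hx (k + 1)
    rwa [mem_preimage, iterZ_add, iterZ_one] at this
  · intro x hx
    refine mem_iInter.2 fun k => ?_
    have := mem_iInter.1 hx (k + -1)
    rwa [mem_preimage, iterZ_add, iterZ_neg_one] at this

/-- A transformation transported along a map which is injective on an invariant measurable set,
and extended by the identity. -/
theorem exists_transported_equiv [StandardBorelSpace Ω] {Y : Type*} [MeasurableSpace Y] [StandardBorelSpace Y] [Nonempty Ω]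
    {φ : Ω → Y} (hφ : Measurable φ) {X : Set Ω} (hX : MeasurableSet X) (hinj : InjOn φ X)
    (hP : ∀ x ∈ X, P x ∈ X) (hP' : ∀ x ∈ X, P.symm x ∈ X) :
    ∃ S : Y ≃ᵐ Y, (∀ x ∈ X, S (φ x) = φ (P x)) ∧ (∀ x ∈ X, S.symm (φ x) = φ (P.symm x)) ∧
      (∀ y ∉ φ '' X, S y = y) ∧ (∀ y ∉ φ '' X, S.symm y = y) ∧
      ∃ ψ : Y → Ω, Measurable ψ ∧ ∀ x ∈ X, ψ (φ x) = x := by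
  classical
  have hXb : StandardBorelSpace X := hX.standardBorel
  have hemb : MeasurableEmbedding fun x : X => φ x :=
    (hφ.comp measurable_subtype_coe).measurableEmbedding
      fun x y hxy => Subtype.ext (hinj x.2 y.2 hxy)
  obtain ⟨ψ, hψ, hψφ⟩ := hemb.exists_measurable_extend (g := fun x : X => (x : Ω))
    measurable_subtype_coe fun _ => inferInstance
  have hψ' : ∀ x ∈ X, ψ (φ x) = x := fun x hx => congrFun hψφ ⟨x, hx⟩
  have hXm : MeasurableSet (φ '' X) := hX.image_of_measurable_injOn hφ hinj
  -- Conjugation on the image of `X`, which is Borel by injectivity, and the identity elsewhere.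
  -- Applied to `P` and `P.symm` it yields everywhere-defined mutual inverses.
  let F : (Ω ≃ᵐ Ω) → Y → Y := fun Q y => if y ∈ φ '' X then φ (Q (ψ y)) else y
  have hF : ∀ Q, Measurable (F Q) := fun Q =>
    Measurable.ite hXm (hφ.comp (Q.measurable.comp hψ)) measurable_id
  have hFφ : ∀ Q, ∀ x ∈ X, F Q (φ x) = φ (Q x) := fun Q x hx => by
    simp only [F, if_pos (mem_image_of_mem φ hx), hψ' x hx]
  have hFn : ∀ Q, ∀ y ∉ φ '' X, F Q y = y := fun Q y hy => by simp only [F, if_neg hy]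
  have hinv : ∀ Q Q' : Ω ≃ᵐ Ω, (∀ x ∈ X, Q x ∈ X) → (∀ x, Q' (Q x) = x) →
      ∀ y, F Q' (F Q y) = y := by
    intro Q Q' hQ hQQ y
    by_cases hy : y ∈ φ '' X
    · obtain ⟨x, hx, rfl⟩ := hy
      rw [hFφ Q x hx, hFφ Q' _ (hQ x hx), hQQ]
    · rw [hFn Q y hy, hFn Q' y hy]
  let S : Y ≃ᵐ Y :=
    { toFun := F P
      invFun := F P.symm
      left_inv := hinv P P.symm hP P.symm_apply_apply
      right_inv := hinv P.symm P hP' P.apply_symm_apply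
      measurable_toFun := hF P
      measurable_invFun := hF P.symm }
  exact ⟨S, hFφ P, hFφ P.symm, hFn P, hFn P.symm, ψ, hψ, hψ'⟩

end Realization

/-! ### The realization theorem -/

theorem mainTheorem1 {Ω : Type*} [MeasurableSpace Ω] [StandardBorelSpace Ω]
    (ν : Measure Ω) [IsFiniteMeasure ν] [NullSingletonClass ν] (hν : ν ≠ 0)
    (P : Ω ≃ᵐ Ω) (hP : Ergodic P ν) :
    ∃ (φ : Ω → ℤ_[2]) (S : ℤ_[2] ≃ᵐ ℤ_[2]) (n : ℤ_[2] → ℤ),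
      -- `S` is an automorphism of the dyadic integers with Haar measure, isomorphic to `P`
      MeasurePreserving S dyadicHaar dyadicHaar ∧
      IsIsoModZero φ ν (ν Set.univ • dyadicHaar) ∧
      (∀ᵐ ω ∂ν, φ (P ω) = S (φ ω)) ∧
      -- `S x = T ^ n(x) x`
      Measurable n ∧
      (∀ x, S x = (odometer.toEquiv ^ n x : Equiv.Perm ℤ_[2]) x) ∧
      -- every orbit of `S` lies in an orbit of `T`
      (∀ x, fullOrbit S x ⊆ fullOrbit odometer x) ∧
      -- almost every orbit of `T` is a union of countably infinitely many orbits of `S`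
      (∀ᵐ x ∂dyadicHaar,
        (fullOrbit S '' fullOrbit odometer x).Countable ∧
        (fullOrbit S '' fullOrbit odometer x).Infinite) := by
  have hν' : ν univ ≠ 0 := fun h => hν (Measure.measure_univ_eq_zero.1 h)
  have hΩ : Nonempty Ω := by
    by_contra hcon
    rw [not_nonempty_iff] at hcon
    exact hν (Measure.eq_zero_of_isEmpty ν)
  obtain ⟨d, hd, hdu, htail, G, hG, hG0, hGinj⟩ := exists_digits hν' hP
  let φ : Ω → ℤ_[2] := fun x => dyadicOfDigits (twist (d x))
  have hφ : MeasurePreserving φ ν (ν univ • dyadicHaar) :=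
    hdu.comp_twist.measurePreserving (measurable_twist.comp hd)
  have hGae : ∀ᵐ x ∂ν, x ∈ G := by
    rw [ae_iff]; exact hG0
  obtain ⟨X, hX, hX0, hXp, hXP, hXP'⟩ :=
    exists_invariant_conull hP.toMeasurePreserving (htail.and hGae)
  have hinj : InjOn φ X := fun x hx y hy hxy =>
    hGinj (hXp x hx).2 (hXp y hy).2 (twist_injective (dyadicOfDigits_injective hxy))
  have htail' : ∀ x ∈ X, ∃ N, ∀ i ≥ N, d (P.symm x) i = d x i := fun x hx => by
    obtain ⟨N, hN⟩ := (hXp _ (hXP' x hx)).1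
    rw [P.apply_symm_apply] at hN
    exact ⟨N, fun i hi => (hN i hi).symm⟩
  obtain ⟨S, hS, hS', hSn, hSn', ψ, hψ, hψφ⟩ :=
    exists_transported_equiv hφ.measurable hX hinj hXP hXP'
  have hXae : ∀ᵐ x ∂ν, x ∈ X := by
    rw [ae_iff]; exact hX0
  have hφX : MeasurableSet (φ '' X) := hX.image_of_measurable_injOn hφ.measurable hinj
  have hφXae : ∀ᵐ y ∂(ν univ • dyadicHaar), y ∈ φ '' X := by
    rw [← hφ.map_eq]
    refine (ae_map_iff hφ.measurable.aemeasurable hφX).2 ?_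
    filter_upwards [hXae] with x hx using mem_image_of_mem φ hx
  have hhaar : dyadicHaar = (ν univ)⁻¹ • (ν univ • dyadicHaar) := by
    rw [smul_smul, ENNReal.inv_mul_cancel hν' (measure_ne_top _ _), one_smul]
  have hφXae' : ∀ᵐ y ∂dyadicHaar, y ∈ φ '' X := by
    rw [hhaar]
    exact Measure.ae_smul_measure hφXae _
  have hcomm : ∀ᵐ x ∂ν, φ (P x) = S (φ x) := by
    filter_upwards [hXae] with x hx using (hS x hx).symm
  have hSpres : MeasurePreserving S (ν univ • dyadicHaar) (ν univ • dyadicHaar) := by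
    refine ⟨S.measurable, ?_⟩
    have h1 : ν.map (S ∘ φ) = ν.map (φ ∘ P) :=
      Measure.map_congr (hcomm.mono fun x hx => hx.symm)
    rw [← hφ.map_eq, Measure.map_map S.measurable hφ.measurable, h1,
      ← Measure.map_map hφ.measurable P.measurable, hP.toMeasurePreserving.map_eq]
  have hψφae : ∀ᵐ x ∂ν, ψ (φ x) = x := by
    filter_upwards [hXae] with x hx using hψφ x hx
  have hshift : ∀ y, ∃ k : ℤ, S y = y + k := by
    intro y
    by_cases hy : y ∈ φ '' X
    · obtain ⟨x, hx, rfl⟩ := hy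
      obtain ⟨N, hN⟩ := (hXp x hx).1
      rw [hS x hx]
      exact exists_intCast_eq_of_tail_eq (twist_tail_eq hN)
    · exact ⟨0, by simp [hSn y hy]⟩
  choose n hn using hshift
  refine ⟨φ, S, n, ?_, ⟨hφ, ψ, ⟨hψ, ?_⟩, hψφae, ?_⟩, hcomm, ?_, ?_, ?_, ?_⟩
  · have := hSpres.smul_measure (ν univ)⁻¹
    rwa [← hhaar] at this
  · rw [← hφ.map_eq, Measure.map_map hψ hφ.measurable,
      Measure.map_congr (f := ψ ∘ φ) (g := id) hψφae, Measure.map_id]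
  · filter_upwards [hφXae] with y hy
    obtain ⟨x, hx, rfl⟩ := hy
    rw [hψφ x hx]
  · refine measurable_to_countable' fun k => ?_
    -- Integers embed in `ℤ_[2]`, so the chosen displacement is unique and its level sets are
    -- measurable.
    have : n ⁻¹' {k} = {y | S y = y + (k : ℤ_[2])} := by
      ext y
      rw [mem_preimage, mem_singleton_iff, Set.mem_ofPred_eq, hn y, add_right_inj, Int.cast_inj]
    rw [this]
    exact measurableSet_eq_fun S.measurable (measurable_id.add_const _)
  · intro y
    rw [odometer_zpow_apply, hn]
  · intro y
    refine forall_mem_fullOrbit (S := S) (p := (· ∈ fullOrbit odometer y)) ?_ ?_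
      (mem_fullOrbit_self _ _)
    · intro z hz
      obtain ⟨k, hk⟩ := mem_fullOrbit_odometer.1 hz
      exact mem_fullOrbit_odometer.2 ⟨k + n z, by rw [hn, hk]; push_cast; ring⟩
    · intro z hz
      obtain ⟨k, hk⟩ := mem_fullOrbit_odometer.1 hz
      refine mem_fullOrbit_odometer.2 ⟨k - n (S.symm z), ?_⟩
      have := hn (S.symm z)
      rw [S.apply_symm_apply] at this
      exact (eq_sub_of_add_eq this.symm).trans (by rw [hk]; push_cast; ring)
  · filter_upwards [hφXae'] with y hy
    refine ⟨(countable_fullOrbit _ _).image _, ?_⟩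
    obtain ⟨x, -, rfl⟩ := hy
    set s := twist (d x) with hs
    -- Flipping the single digit `2 * j + 1` stays in the odometer orbit; the resulting points are
    -- shown to have pairwise different `S`-orbits.
    let flip : ℕ → ℕ → Bool := fun j => Function.update s (2 * j + 1) !(s (2 * j + 1))
    refine infinite_of_injective_forall_mem (f := fun j => fullOrbit S (dyadicOfDigits (flip j)))
      ?_ fun j => ⟨_, ?_, rfl⟩
    · intro j j' hjj
      by_contra hne
      have hmem : dyadicOfDigits (flip j') ∈ fullOrbit S (dyadicOfDigits (flip j)) := by
        have h1 : fullOrbit S (dyadicOfDigits (flip j)) = fullOrbit S (dyadicOfDigits (flip j')) := hjj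
        rw [h1]
        exact mem_fullOrbit_self _ _
      -- The tail class of the untwisted digits is an `S`-invariant: on the image of `X` it is the
      -- tail class of `d`, preserved by `P`. Flipped points may fall outside that image, but there
      -- `S` is the identity.
      have hinv := forall_mem_fullOrbit (S := S) (p := fun z => ∃ u, z = dyadicOfDigits (twist u) ∧
        ∃ N, ∀ i ≥ N, u i = untwist (flip j) i) ?_ ?_
        ⟨untwist (flip j), by rw [twist_untwist], 0, fun _ _ => rfl⟩ _ hmem
      · obtain ⟨u, hu, N, hN⟩ := hinv
        have hu' : u = untwist (flip j') :=
          twist_injective (by rw [← dyadicOfDigits_injective hu, twist_untwist])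
        obtain ⟨i, hi, hne'⟩ := not_tail_eq_untwist_update (s := s) hne N
        exact hne' (by rw [← hN i hi, hu'])
      · rintro z ⟨u, rfl, N, hN⟩
        by_cases hz : dyadicOfDigits (twist u) ∈ φ '' X
        · obtain ⟨w, hw, hwu⟩ := hz
          obtain ⟨N', hN'⟩ := (hXp w hw).1
          have hdw : d w = u := twist_injective (dyadicOfDigits_injective hwu)
          refine ⟨d (P w), (congrArg S hwu).symm.trans (hS w hw), max N N', fun i hi => ?_⟩
          rw [hN' i (le_of_max_le_right hi), hdw, hN i (le_of_max_le_left hi)]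
        · exact ⟨u, hSn _ hz, N, hN⟩
      · rintro z ⟨u, rfl, N, hN⟩
        by_cases hz : dyadicOfDigits (twist u) ∈ φ '' X
        · obtain ⟨w, hw, hwu⟩ := hz
          obtain ⟨N', hN'⟩ := htail' w hw
          have hdw : d w = u := twist_injective (dyadicOfDigits_injective hwu)
          refine ⟨d (P.symm w), (congrArg S.symm hwu).symm.trans (hS' w hw), max N N', fun i hi => ?_⟩
          rw [hN' i (le_of_max_le_right hi), hdw, hN i (le_of_max_le_left hi)]
        · exact ⟨u, hSn' _ hz, N, hN⟩
    · refine mem_fullOrbit_odometer.2 (exists_intCast_eq_of_tail_eq (N := 2 * j + 2) fun i hi => ?_)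
      exact Function.update_of_ne (by omega) _ _
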